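/- Let $\mathcal{X}$ be a finite or countable set, $A\subset\mathcal{X}$ a set of interesting items, and $P_1,\dots,P_K$ ($K\ge 1$) probability distributions on $\mathcal{X}$ (the experts) such that no interesting item is shared by two of them: $A\cap\mathrm{supp}(P_i)\cap\mathrm{supp}(P_j)=\emptyset$ for $i\ne j$. Let $X_{i,n}$ ($1\le i\le K$, $n\ge 1$) be independent, with $X_{i,n}$ distributed as $P_i$. A policy $\pi$ requests at each time $t\ge 1$ an expert $I_t$, chosen as a (possibly randomized) function of the past requests and observations, and observes $X_{I_t,n_{I_t,t}}$, where $n_{i,t}=\#\{s\le t: I_s=i\}$; $F^\pi(t)$ is the number of distinct elements of $A$ observed during its first $t$ requests. *Good-UCB* with parameter $C$ requests $I_t=t$ for $1\le t\le K$ and, for $t\ge K+1$, $$I_t\in\operatorname*{argmax}_{1\le i\le K}\left\{\frac{U_{i,t-1}}{n_{i,t-1}}+C\sqrt{\frac{\log(4t)}{n_{i,t-1}}}\right\},$$ where $U_{i,t-1}$ is the number of items of $A$ that were observed exactly once during the first $t-1$ requests, that observation coming from expert $i$. The *oracle closed-loop policy* (OCL), which knows $A$ and the $P_i$, requests at each time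 $t\ge 1$ $$I^*_t\in\operatorname*{argmax}_{1\le i\le K} P_i\big(A\setminus\{X_{i,1},\dots,X_{i,n^*_{i,t-1}}\}\big),\qquad n^*_{i,t}=\#\{s\le t: I^*_s=i\}.$$ In both, ties are broken arbitrarily (possibly at random, but without using unobserved $X_{i,n}$). Let $F^{UCB}(t)$ and $F^*(t)$ be the numbers of interesting items found in $t$ requests by Good-UCB with $C=(1+\sqrt2)\sqrt3$ and by OCL, both run on the same variables $X_{i,n}$. Then, for every integer $t\ge K$, $$\mathbb{E}\left[F^*(t)-F^{UCB}(t)\right]\le 17\sqrt{Kt\log t}+20\sqrt{Kt}+K+K\log(t/K).$$ -/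

import Mathlib

open MeasureTheory ProbabilityTheory

namespace Discovery

/-- The past of the discovery process: the list of pairs (requested expert, observed item),
most recent request first. A history of length `t` is what is known after `t` requests. -/
abbrev History (K : ℕ) (E : Type*) := List (Fin K × E)

/-- A policy chooses the next expert as a function of the past requests and observations. -/
abbrev Policy (K : ℕ) (E : Type*) := History K E → Fin K

variable {K : ℕ} {E : Type*}

/-- The number `n_i` of requests made to expert `i` in the history `h`. -/
def pulls (h : History K E) (i : Fin K) : ℕ :=
  h.countP (fun p => p.1 = i)

/-- The history of the first `t` requests of the policy `π`, where `x i n` is the answer of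
expert `i` to the `(n + 1)`-st request that is made to it. -/
def run (π : Policy K E) (x : Fin K → ℕ → E) : ℕ → History K E
  | 0 => []
  | t + 1 =>
    (π (run π x t), x (π (run π x t)) (pulls (run π x t) (π (run π x t)))) :: run π x t

/-- The number of interesting items (elements of `A`) found, each counted once. -/
noncomputable def found (A : Set E) (h : History K E) : ℕ :=
  {y | y ∈ A ∧ ∃ i, (i, y) ∈ h}.ncard

open Classical in
/-- The number of times expert `i` answered `y`. -/
noncomputable def occ (h : History K E) (i : Fin K) (y : E) : ℕ :=
  h.countP (fun p => p = (i, y))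

/-- The number of interesting items which expert `i` produced exactly once and which were
seen exactly once overall. -/
noncomputable def hapaxes (A : Set E) (h : History K E) (i : Fin K) : ℕ :=
  {y | y ∈ A ∧ occ h i y = 1 ∧ ∑ j, occ h j y = 1}.ncard

/-- The Good-Turing estimate of the missing mass of expert `i`. It is used only when
`pulls h i` is positive. -/
noncomputable def goodTuring (A : Set E) (h : History K E) (i : Fin K) : ℝ :=
  (hapaxes A h i : ℝ) / (pulls h i : ℝ)

/-- The Good-UCB index of expert `i` at time `h.length + 1`, with parameter `C`. -/
noncomputable def ucbIndex (A : Set E) (C : ℝ) (h : History K E) (i : Fin K) : ℝ :=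
  goodTuring A h i +
    C * Real.sqrt (Real.log (4 * ((h.length : ℝ) + 1)) / (pulls h i : ℝ))

/-- `π` is a version of Good-UCB with parameter `C`: the first `K` requests go to the
experts in turn, and then an expert of maximal index is requested, ties being broken in any
way. (After the first `K` requests of such a policy every `pulls h i` is positive.) -/
def IsGoodUCB (A : Set E) (C : ℝ) (π : Policy K E) : Prop :=
  ∀ h : History K E,
    (∀ hl : h.length < K, π h = ⟨h.length, hl⟩) ∧
    (K ≤ h.length → ∀ j, ucbIndex A C h j ≤ ucbIndex A C h (π h))

variable [MeasurableSpace E]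

/-- The missing mass of expert `i`: the `P i`-probability of the set of the interesting items
that expert `i` has not produced so far. -/
noncomputable def missingMass (A : Set E) (P : Fin K → Measure E) (h : History K E)
    (i : Fin K) : ℝ :=
  (P i).real (A \ {y | (i, y) ∈ h})

/-- `π` is a version of the oracle closed-loop policy: it always requests an expert of maximal
missing mass, ties being broken in any way. -/
def IsOCL (A : Set E) (P : Fin K → Measure E) (π : Policy K E) : Prop :=
  ∀ (h : History K E) (j : Fin K), missingMass A P h j ≤ missingMass A P h (π h)

/-- The support of a distribution on a countable set: the points of positive mass. -/
def supp (ν : Measure E) : Set E := {y | ν {y} ≠ 0}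

/-- No interesting item lies in the supports of two distinct experts. -/
def NonIntersecting (A : Set E) (P : Fin K → Measure E) : Prop :=
  ∀ i j, i ≠ j → A ∩ supp (P i) ∩ supp (P j) = ∅

end Discovery

/-! Given the past, a request to an expert finds a new item with probability equal to that expert's
missing mass; items found through other experts do not matter, since interesting supports are
disjoint. Expected finds are therefore expected sums of requested missing masses
(`integral_found_run`), and these sums can be compared on one fixed array of answers.

The oracle's current missing mass never exceeds the largest one available to Good-UCB at the same
time (`IsOCL.exists_missingMass_le`): either the request counts agree, or Good-UCB has explored some
expert less, and the oracle requested that expert at that very level earlier, when its maximum was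
no smaller. While the Good-Turing confidence bounds hold, Good-UCB loses at most a width `1/n +
2C√(log(4(s+1))/n)` against that largest mass (`IsGoodUCB.missingMass_le`). Summing widths expert by
expert, with Cauchy-Schwarz and concavity of log, gives `sum_missingMass_sub_le`.

The bounds rarely fail. The missing mass after `n` draws is sub-Gaussian with proxy `1/n` (negative
dependence of the unseen indicators and a Kearns-Saul bound), and so is the Good-Turing estimate
(McDiarmid). Their difference has proxy `4/n`, so a radius `4√(L/n)` fails with probability at most
`exp(-2L)`, and `4 ≤ C`. The bias of the estimate lies in `[0, 1/n]`. With `L = log(4(s+1))` a union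
bound gives failure probability at most `K/(8(s+1))`, hence `(K/8) log(t/K)` in total. -/

namespace Discovery

open Real NNReal

/-! ### McDiarmid's inequality for i.i.d. draws from a countable space. -/

section ProductMeasure

variable {E : Type*}

lemma abs_sub_le_of_bounded_differences : ∀ {n : ℕ} {f : (Fin n → E) → ℝ} {c : ℝ},
    (∀ x k y, |f (Function.update x k y) - f x| ≤ c) → ∀ x y, |f x - f y| ≤ n * c := by
  intro n
  induction n with
  | zero => intro f c _ x y; simp [Subsingleton.elim x y]
  | succ n ih =>
    intro f c hf x y
    have h1 := hf y 0 (x 0)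
    have h2 := ih (f := fun z => f (Fin.cons (x 0) z : Fin (n + 1) → E)) (c := c)
      (fun z k w => by
        have := hf (Fin.cons (x 0) z : Fin (n + 1) → E) k.succ w
        rwa [← Fin.cons_update] at this) (Fin.tail x) (Fin.tail y)
    simp only [Fin.cons_self_tail] at h2
    have h3 : Function.update y 0 (x 0) = (Fin.cons (x 0) (Fin.tail y) : Fin (n + 1) → E) := by
      conv_lhs => rw [← Fin.cons_self_tail y]
      rw [Fin.update_cons_zero]
    rw [h3] at h1
    push_cast
    calc _ ≤ _ := abs_sub_le _ (f (Fin.cons (x 0) (Fin.tail y) : Fin (n + 1) → E)) _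
      _ ≤ n * c + c := add_le_add h2 h1
      _ = _ := by ring

lemma exists_abs_le_of_bounded_differences {n : ℕ} {f : (Fin n → E) → ℝ} {c : ℝ}
    (hf : ∀ x k y, |f (Function.update x k y) - f x| ≤ c) : ∃ B, ∀ x, |f x| ≤ B := by
  rcases isEmpty_or_nonempty (Fin n → E) with h | ⟨⟨x₀⟩⟩
  · exact ⟨0, fun x => isEmptyElim x⟩
  · refine ⟨n * c + |f x₀|, fun x => ?_⟩
    have h1 := abs_sub_le_of_bounded_differences hf x x₀
    have h2 := abs_sub_abs_le_abs_sub (f x) (f x₀)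
    linarith

variable [Countable E] [MeasurableSpace E] [MeasurableSingletonClass E]

/-- On a countable space with measurable points every function is measurable, so boundedness is all
that integrability requires. -/
lemma integrable_of_abs_le {α : Type*} [Countable α] [MeasurableSpace α]
    [MeasurableSingletonClass α] (ν : Measure α) [IsFiniteMeasure ν] {f : α → ℝ} {B : ℝ}
    (hf : ∀ x, |f x| ≤ B) : Integrable f ν :=
  Integrable.of_bound (measurable_of_countable f).aestronglyMeasurable B
    (Filter.Eventually.of_forall hf)

lemma abs_integral_le_of_abs_le {α : Type*} [MeasurableSpace α] (ν : Measure α)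
    [IsProbabilityMeasure ν] {f : α → ℝ} {B : ℝ} (hf : ∀ x, |f x| ≤ B) : |∫ x, f x ∂ν| ≤ B := by
  have h := norm_integral_le_of_norm_le_const (μ := ν) (f := f) (C := B)
    (Filter.Eventually.of_forall hf)
  simpa using h

variable (ν : Measure E) [IsProbabilityMeasure ν]

/-- The law of `n` independent draws from `ν`. -/
noncomputable abbrev draws (n : ℕ) : Measure (Fin n → E) := Measure.pi fun _ => ν

lemma integral_draws_succ {n : ℕ} {f : (Fin (n + 1) → E) → ℝ} {B : ℝ} (hf : ∀ x, |f x| ≤ B) :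
    ∫ x, f x ∂(draws ν (n + 1)) =
      ∫ x, ∫ y, f (Fin.cons y x : Fin (n + 1) → E) ∂ν ∂(draws ν n) := by
  have h := (measurePreserving_piFinSuccAbove (fun _ : Fin (n + 1) => ν) 0).symm
  rw [← h.integral_comp', integral_prod_symm]
  · congr with x
    congr with y
    simp [MeasurableEquiv.piFinSuccAbove, Fin.insertNthEquiv]
  · exact integrable_of_abs_le (B := B) _ fun p => hf _

/-- Hoeffding's lemma for a function on a probability space whose oscillation is at most `c`. -/
lemma integral_exp_le_of_oscillation {f : E → ℝ} {c : ℝ} (hf : ∀ x y, f x - f y ≤ c) (l : ℝ) :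
    ∫ x, exp (l * f x) ∂ν ≤ exp (l * ∫ x, f x ∂ν) * exp (c ^ 2 / 4 * l ^ 2 / 2) := by
  obtain ⟨x₀⟩ := ν.nonempty_of_neZero
  have hc : 0 ≤ c := by simpa using hf x₀ x₀
  have hbdd : BddBelow (Set.range f) := by
    refine ⟨f x₀ - c, ?_⟩
    rintro _ ⟨x, rfl⟩
    linarith [hf x₀ x]
  have hmem : ∀ x, f x ∈ Set.Icc (⨅ y, f y) ((⨅ y, f y) + c) := by
    intro x
    have : Nonempty E := ⟨x₀⟩
    refine ⟨ciInf_le hbdd x, ?_⟩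
    have : f x - c ≤ ⨅ y, f y := le_ciInf fun y => by linarith [hf x y]
    linarith
  have h := (hasSubgaussianMGF_of_mem_Icc (μ := ν) (measurable_of_countable f).aemeasurable
    (Filter.Eventually.of_forall hmem)).mgf_le l
  have e1 : mgf (fun x => f x - ∫ y, f y ∂ν) ν l
      = exp (-(l * ∫ x, f x ∂ν)) * ∫ x, exp (l * f x) ∂ν := by
    rw [mgf, ← integral_const_mul]
    congr 1
    ext x
    rw [← exp_add]
    ring_nf
  rw [e1] at h
  have e2 : (((‖(⨅ y, f y) + c - ⨅ y, f y‖₊ / 2) ^ 2 : ℝ≥0) : ℝ) = c ^ 2 / 4 := by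
    push_cast
    rw [add_sub_cancel_left, norm_eq_abs, abs_of_nonneg hc]
    ring
  rw [e2] at h
  calc _ = exp (l * ∫ x, f x ∂ν) * (exp (-(l * ∫ x, f x ∂ν)) * ∫ x, exp (l * f x) ∂ν) := by
        rw [← mul_assoc, ← exp_add]; simp
    _ ≤ _ := by gcongr

/-- Integrate out the first coordinate: by Hoeffding's lemma this costs a factor `exp(c²l²/8)`, and
the partial mean `g` inherits the bounded differences. -/
lemma integral_exp_le_of_bounded_differences (l : ℝ) : ∀ {n : ℕ} {f : (Fin n → E) → ℝ} {c : ℝ},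
    (∀ x k y, |f (Function.update x k y) - f x| ≤ c) →
    ∫ x, exp (l * f x) ∂(draws ν n) ≤
      exp (l * ∫ x, f x ∂(draws ν n)) * exp (n * c ^ 2 / 4 * l ^ 2 / 2) := by
  intro n
  induction n with
  | zero =>
    intro f c _
    obtain ⟨a, rfl⟩ : ∃ a, f = fun _ => a :=
      ⟨f Fin.elim0, funext fun x => by rw [Subsingleton.elim x Fin.elim0]⟩
    simp
  | succ n ih =>
    intro f c hf
    obtain ⟨B, hB⟩ := exists_abs_le_of_bounded_differences hf
    have hexp : ∀ a : ℝ, |a| ≤ B → |exp (l * a)| ≤ exp (|l| * B) := by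
      intro a ha
      rw [abs_of_pos (exp_pos _), exp_le_exp]
      calc l * a ≤ |l * a| := le_abs_self _
        _ = |l| * |a| := abs_mul _ _
        _ ≤ _ := by gcongr
    rw [integral_draws_succ ν (fun x => hexp _ (hB x)), integral_draws_succ ν hB]
    set g : (Fin n → E) → ℝ := fun x => ∫ y, f (Fin.cons y x : Fin (n + 1) → E) ∂ν with hg
    have hgB : ∀ x, |g x| ≤ B := fun x => abs_integral_le_of_abs_le ν fun y => hB _
    have hgc : ∀ x k y, |g (Function.update x k y) - g x| ≤ c := by
      intro x k y
      rw [hg]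
      simp only
      rw [← integral_sub (integrable_of_abs_le ν fun y => hB _)
        (integrable_of_abs_le ν fun y => hB _)]
      refine abs_integral_le_of_abs_le ν fun z => ?_
      have := hf (Fin.cons z x : Fin (n + 1) → E) k.succ y
      rwa [← Fin.cons_update] at this
    have hstep : ∀ x, ∫ y, exp (l * f (Fin.cons y x : Fin (n + 1) → E)) ∂ν
        ≤ exp (l * g x) * exp (c ^ 2 / 4 * l ^ 2 / 2) := by
      intro x
      refine integral_exp_le_of_oscillation ν (fun y z => ?_) l
      have := hf (Fin.cons z x : Fin (n + 1) → E) 0 y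
      rw [Fin.update_cons_zero] at this
      exact (le_abs_self _).trans this
    calc _ ≤ ∫ x, exp (l * g x) * exp (c ^ 2 / 4 * l ^ 2 / 2) ∂(draws ν n) := by
          refine integral_mono ?_ ?_ hstep
          · exact integrable_of_abs_le _ fun x =>
              abs_integral_le_of_abs_le ν fun y => hexp _ (hB _)
          · exact (integrable_of_abs_le _ fun x => hexp _ (hgB x)).mul_const _
      _ = (∫ x, exp (l * g x) ∂(draws ν n)) * exp (c ^ 2 / 4 * l ^ 2 / 2) :=
          integral_mul_const _ _
      _ ≤ (exp (l * ∫ x, g x ∂(draws ν n)) * exp (n * c ^ 2 / 4 * l ^ 2 / 2)) *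
          exp (c ^ 2 / 4 * l ^ 2 / 2) := by gcongr; exact ih hgc
      _ = _ := by
          rw [mul_assoc, ← exp_add]
          push_cast
          ring_nf

lemma hasSubgaussianMGF_of_integral_exp_le {α : Type*} [Countable α] [MeasurableSpace α]
    [MeasurableSingletonClass α] (ρ : Measure α) [IsProbabilityMeasure ρ] {f : α → ℝ} {B : ℝ}
    (hB : ∀ x, |f x| ≤ B) {c : ℝ≥0}
    (h : ∀ l, ∫ x, exp (l * f x) ∂ρ ≤ exp (l * ∫ x, f x ∂ρ) * exp (c * l ^ 2 / 2)) :
    HasSubgaussianMGF (fun x => f x - ∫ y, f y ∂ρ) c ρ where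
  integrable_exp_mul l := by
    refine integrable_of_abs_le (B := exp (|l| * (B + |∫ y, f y ∂ρ|))) ρ fun x => ?_
    rw [abs_of_pos (exp_pos _), exp_le_exp]
    calc l * (f x - ∫ y, f y ∂ρ) ≤ |l * (f x - ∫ y, f y ∂ρ)| := le_abs_self _
      _ = |l| * |f x - ∫ y, f y ∂ρ| := abs_mul _ _
      _ ≤ _ := by
        gcongr
        exact (abs_sub _ _).trans (by gcongr; exact hB x)
  mgf_le l := by
    have e1 : mgf (fun x => f x - ∫ y, f y ∂ρ) ρ l
        = exp (-(l * ∫ x, f x ∂ρ)) * ∫ x, exp (l * f x) ∂ρ := by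
      rw [mgf, ← integral_const_mul]
      congr 1
      ext x
      rw [← exp_add]
      ring_nf
    rw [e1]
    calc _ ≤ exp (-(l * ∫ x, f x ∂ρ)) * (exp (l * ∫ x, f x ∂ρ) * exp (c * l ^ 2 / 2)) := by
          gcongr; exact h l
      _ = _ := by rw [← mul_assoc, ← exp_add]; simp

/-- McDiarmid's inequality. -/
lemma hasSubgaussianMGF_of_bounded_differences {n : ℕ} {f : (Fin n → E) → ℝ} {c : ℝ≥0}
    (hf : ∀ x k y, |f (Function.update x k y) - f x| ≤ c) :
    HasSubgaussianMGF (fun x => f x - ∫ y, f y ∂(draws ν n)) (n * c ^ 2 / 4) (draws ν n) := by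
  obtain ⟨B, hB⟩ := exists_abs_le_of_bounded_differences hf
  refine hasSubgaussianMGF_of_integral_exp_le _ hB fun l => ?_
  simpa using integral_exp_le_of_bounded_differences ν l hf

end ProductMeasure

/-! ### Exponential moments of Bernoulli variables of small mean. -/

section Bernoulli

/-- This is the monotonicity of `(exp x - 1 - x) / x²` on `x ≥ 0`; convexity of exp makes the
derivative of the difference nonnegative. -/
lemma exp_mul_sub_le {θ : ℝ} (h0 : 0 ≤ θ) (h1 : θ ≤ 1) {l : ℝ} (hl : 0 ≤ l) :
    exp (θ * l) - 1 - θ * l ≤ θ ^ 2 * (exp l - 1 - l) := by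
  have hd : ∀ x : ℝ, HasDerivAt (fun x => θ ^ 2 * (exp x - 1 - x) - (exp (θ * x) - 1 - θ * x))
      (θ ^ 2 * (exp x - 1) - (exp (θ * x) * θ - θ)) x := by
    intro x
    have a1 := (((hasDerivAt_exp x).sub_const 1).sub (hasDerivAt_id x)).const_mul (θ ^ 2)
    have a2 : HasDerivAt (fun x => θ * x) θ x := by simpa using (hasDerivAt_id x).const_mul θ
    exact a1.sub ((a2.exp.sub_const 1).sub a2)
  have hmono : MonotoneOn (fun x => θ ^ 2 * (exp x - 1 - x) - (exp (θ * x) - 1 - θ * x))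
      (Set.Ici 0) := by
    refine monotoneOn_of_deriv_nonneg (convex_Ici 0)
      (fun x _ => (hd x).continuousAt.continuousWithinAt)
      (fun x _ => (hd x).differentiableAt.differentiableWithinAt) ?_
    intro x _
    rw [(hd x).deriv]
    have hc := convexOn_exp.2 (Set.mem_univ x) (Set.mem_univ 0) h0 (sub_nonneg.2 h1) (by ring)
    simp only [smul_eq_mul, mul_zero, add_zero, exp_zero, mul_one] at hc
    nlinarith
  have := hmono (Set.mem_Ici.2 le_rfl) (Set.mem_Ici.2 hl) hl
  simp only [exp_zero, mul_zero, sub_self] at this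
  linarith

lemma exp_le_one_add_add_sq_half {u : ℝ} (hu : u ≤ 0) : exp u ≤ 1 + u + u ^ 2 / 2 := by
  have hd : ∀ x : ℝ, HasDerivAt (fun x => 1 + x + x ^ 2 / 2 - exp x) (1 + x - exp x) x := by
    intro x
    have := (((hasDerivAt_id x).const_add 1).add (((hasDerivAt_pow 2 x)).div_const 2)).sub
      (hasDerivAt_exp x)
    refine this.congr_deriv ?_
    push_cast
    ring
  have hanti : AntitoneOn (fun x => 1 + x + x ^ 2 / 2 - exp x) (Set.Iic 0) := by
    refine antitoneOn_of_deriv_nonpos (convex_Iic 0)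
      (fun x _ => (hd x).continuousAt.continuousWithinAt)
      (fun x _ => (hd x).differentiableAt.differentiableWithinAt) ?_
    intro x _
    rw [(hd x).deriv]
    linarith [add_one_le_exp x]
  have := hanti (Set.mem_Iic.2 hu) (Set.mem_Iic.2 le_rfl) hu
  simp at this
  linarith

/-- A form of the Kearns-Saul inequality: a centred Bernoulli variable of small mean `exp (-l)`
has variance proxy at most `1 / l`. -/
lemma one_add_exp_sub_one_mul_exp_neg_le {l : ℝ} (hl : 0 < l) (u : ℝ) :
    1 + (exp u - 1) * exp (-l) ≤ exp (exp (-l) * u + u ^ 2 / (2 * l)) := by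
  set q := exp (-l) with hq
  have hq0 : 0 < q := exp_pos _
  have hq1 : q < 1 := by rw [hq, exp_lt_one_iff]; linarith
  have hql : q * l ≤ 1 := by
    have h1 : l ≤ exp l := by linarith [add_one_le_exp l]
    calc q * l ≤ q * exp l := by gcongr
      _ = 1 := by rw [hq, ← exp_add]; simp
  have key : ∀ v, q * (exp u - 1 - u) ≤ v →  1 + (exp u - 1) * q ≤ exp (q * u + v) := by
    intro v hv
    have := add_one_le_exp (q * u + v)
    nlinarith
  rcases le_total u 0 with hu | hu
  · refine key _ ?_
    have h1 := exp_le_one_add_add_sq_half hu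
    calc q * (exp u - 1 - u) ≤ q * (u ^ 2 / 2) := by gcongr; linarith
      _ = (q * l) * (u ^ 2 / (2 * l)) := by field_simp
      _ ≤ 1 * (u ^ 2 / (2 * l)) := by gcongr
      _ = _ := one_mul _
  -- For `l ≤ 2`, bound `exp(-qu)` by Jensen. The product is then at most `cosh(u/2)²` because
  -- `4q(1-q) ≤ 1`, hence at most `exp(u²/4)`, which suffices since `2l ≤ 4`.
  rcases le_total l 2 with h2 | h2
  · have hj := convexOn_exp.2 (Set.mem_univ (-u)) (Set.mem_univ 0) hq0.le (sub_nonneg.2 hq1.le)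
      (by ring)
    simp only [smul_eq_mul, mul_zero, add_zero, exp_zero, mul_one] at hj
    have hx : exp u * exp (-u) = 1 := by rw [← exp_add]; simp
    have hc1 := cosh_le_exp_half_sq (u / 2)
    have hc0 : 1 ≤ cosh (u / 2) := one_le_cosh _
    have hcu : exp u + exp (-u) = 2 * cosh u := by rw [cosh_eq]; ring
    have hcd : cosh u = 2 * cosh (u / 2) ^ 2 - 1 := by
      have := cosh_two_mul (u / 2)
      rw [mul_div_cancel₀ _ (two_ne_zero)] at this
      have h4 := cosh_sq (u / 2)
      linarith
    have hpos : 0 < 1 + (exp u - 1) * q := by nlinarith [one_le_exp hu]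
    have hprod : (1 + (exp u - 1) * q) * exp (q * -u) ≤ cosh (u / 2) ^ 2 := by
      calc _ ≤ (1 + (exp u - 1) * q) * (q * exp (-u) + (1 - q)) := by gcongr
        _ = 1 + q * (1 - q) * (exp u + exp (-u) - 2) + q ^ 2 * (exp u * exp (-u) - 1) := by ring
        _ = 1 + q * (1 - q) * (4 * (cosh (u / 2) ^ 2 - 1)) := by rw [hx, hcu, hcd]; ring
        _ ≤ _ := by nlinarith [sq_nonneg (q - 1 / 2), one_le_pow₀ hc0 (n := 2)]
    have hfin : cosh (u / 2) ^ 2 ≤ exp (u ^ 2 / (2 * l)) := by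
      calc cosh (u / 2) ^ 2 ≤ exp ((u / 2) ^ 2 / 2) ^ 2 := by gcongr
        _ = exp (u ^ 2 / 4) := by rw [← exp_nat_mul]; congr 1; push_cast; ring
        _ ≤ _ := by
          rw [exp_le_exp]
          apply div_le_div_of_nonneg_left <;> nlinarith [sq_nonneg u]
    calc _ = (1 + (exp u - 1) * q) * exp (q * -u) * exp (q * u) := by
          rw [mul_assoc, ← exp_add]; simp
      _ ≤ exp (u ^ 2 / (2 * l)) * exp (q * u) := by gcongr; exact hprod.trans hfin
      _ = _ := by rw [← exp_add, add_comm]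
  -- Now `l ≥ 2`. For `u ≤ l` the monotonicity lemma gives `u²/l²`, as `q * exp l = 1`. For `u ≥ l`
  -- the left side is at most `2 exp(u - l)`, and `u²/(2l) ≥ u - l/2 ≥ 1 + u - l`.
  rcases le_total u l with hul | hul
  · refine key _ ?_
    have h1 := exp_mul_sub_le (θ := u / l) (by positivity) ((div_le_one hl).2 hul) hl.le
    rw [div_mul_cancel₀ _ hl.ne'] at h1
    calc q * (exp u - 1 - u) ≤ q * ((u / l) ^ 2 * exp l) := by
          gcongr
          refine h1.trans ?_
          gcongr
          linarith
      _ = (u / l) ^ 2 := by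
          have : q * exp l = 1 := by rw [hq, ← exp_add]; simp
          linear_combination (u / l) ^ 2 * this
      _ = u ^ 2 / (l * l) := by ring
      _ ≤ _ := by gcongr
  · have h1 : 1 + (exp u - 1) * q ≤ 2 * exp (u - l) := by
      have h3 : exp u * q = exp (u - l) := by rw [hq, ← exp_add]; ring_nf
      have h4 : 1 ≤ exp (u - l) := one_le_exp (by linarith)
      nlinarith
    have h5 : (2 : ℝ) ≤ exp 1 := by linarith [add_one_le_exp (1 : ℝ)]
    calc _ ≤ exp 1 * exp (u - l) := h1.trans (by gcongr)
      _ = exp (1 + (u - l)) := (exp_add _ _).symm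
      _ ≤ _ := by
        rw [exp_le_exp]
        have h6 : u ^ 2 / (2 * l) = (u - l) ^ 2 / (2 * l) + u - l / 2 := by field_simp; ring
        have h7 : 0 ≤ (u - l) ^ 2 / (2 * l) := by positivity
        have h8 : 0 ≤ q * u := by positivity
        rw [h6]
        linarith

/-- Write `(1-p)^n = exp(-l')` with `l' = -n log(1-p) ≥ np`: the proxy `p²/l'` is at most `p/n`.
Being linear in `p`, it sums over the items to at most `1/n`. -/
lemma one_add_exp_sub_one_mul_one_sub_pow_le {p : ℝ} (h0 : 0 ≤ p) (h1 : p ≤ 1) {n : ℕ}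
    (hn : n ≠ 0) (l : ℝ) :
    1 + (exp (l * p) - 1) * (1 - p) ^ n ≤
      exp (l * (p * (1 - p) ^ n) + p * (1 / n * l ^ 2 / 2)) := by
  have hn' : (0 : ℝ) < n := by positivity
  rcases h0.eq_or_lt with rfl | h0
  · simp
  rcases h1.eq_or_lt with rfl | h1
  · simp only [sub_self, zero_pow hn, mul_zero, add_zero, zero_add]
    exact one_le_exp (by positivity)
  have hlog : (1 - p) ^ n = exp (-(-(n * log (1 - p)))) := by
    rw [neg_neg, exp_nat_mul, exp_log (by linarith)]
  have hl : n * p ≤ -(n * log (1 - p)) := by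
    have := log_le_sub_one_of_pos (show 0 < 1 - p by linarith)
    nlinarith
  have hpos : 0 < -(n * log (1 - p)) := lt_of_lt_of_le (by positivity) hl
  have := one_add_exp_sub_one_mul_exp_neg_le hpos (l * p)
  rw [hlog]
  refine this.trans ?_
  rw [exp_le_exp]
  have h3 : (l * p) ^ 2 / (2 * -(n * log (1 - p))) ≤ (l * p) ^ 2 / (2 * (n * p)) := by gcongr
  have h4 : (l * p) ^ 2 / (2 * (n * p)) = p * (1 / n * l ^ 2 / 2) := by field_simp
  linarith

end Bernoulli

end Discovery

namespace Discovery

open Real NNReal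

/-! ### Concentration of the missing mass. -/

section MissingMass

variable {E : Type*}

open Classical in
/-- The indicator that the item `y` does not occur in the sample `x`. -/
noncomputable def unseen {n : ℕ} (y : E) (x : Fin n → E) : ℝ :=
  if y ∈ Set.range x then 0 else 1

lemma unseen_nonneg {n : ℕ} (y : E) (x : Fin n → E) : 0 ≤ unseen y x := by
  unfold unseen; split_ifs <;> norm_num

lemma unseen_le_one {n : ℕ} (y : E) (x : Fin n → E) : unseen y x ≤ 1 := by
  unfold unseen; split_ifs <;> norm_num

lemma unseen_cons {n : ℕ} (y z : E) (x : Fin n → E) [Decidable (z = y)] :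
    unseen y (Fin.cons z x : Fin (n + 1) → E) = (if z = y then 0 else 1) * unseen y x := by
  have h0 : y ∈ Set.range (Fin.cons z x : Fin (n + 1) → E) ↔ z = y ∨ y ∈ Set.range x := by
    rw [Fin.range_cons, Set.mem_insert_iff, eq_comm]
  unfold unseen
  by_cases h : y ∈ Set.range (Fin.cons z x : Fin (n + 1) → E)
  · rw [if_pos h]
    rcases h0.1 h with h | h
    · rw [if_pos h, zero_mul]
    · rw [if_pos h, mul_zero]
  · rw [if_neg h, if_neg fun e => h (h0.2 (.inl e)), if_neg fun e => h (h0.2 (.inr e)), one_mul]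

lemma unseen_le_unseen_update {n : ℕ} {y z : E} (h : z ≠ y) (x : Fin n → E) (k : Fin n) :
    unseen z x ≤ unseen z (Function.update x k y) := by
  unfold unseen
  split_ifs with h1 h2 h2
  · rfl
  · norm_num
  · exfalso
    obtain ⟨j, hj⟩ := h2
    by_cases hjk : j = k
    · subst hjk; simp at hj; exact h hj.symm
    · rw [Function.update_of_ne hjk] at hj
      exact h1 ⟨j, hj⟩
  · rfl

lemma abs_prod_one_add_mul_unseen_le {n : ℕ} (F : Finset E) (a : E → ℝ) (x : Fin n → E) :
    |∏ y ∈ F, (1 + a y * unseen y x)| ≤ ∏ y ∈ F, (1 + |a y|) := by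
  rw [Finset.abs_prod]
  refine Finset.prod_le_prod (fun _ _ => abs_nonneg _) fun y _ => ?_
  refine (abs_add_le _ _).trans ?_
  rw [abs_one, abs_mul, abs_of_nonneg (unseen_nonneg y x)]
  have := mul_le_mul_of_nonneg_left (unseen_le_one y x) (abs_nonneg (a y))
  linarith

variable [Countable E] [MeasurableSpace E] [MeasurableSingletonClass E]
variable (ν : Measure E) [IsProbabilityMeasure ν]

lemma integral_mul_ite_eq {f : E → ℝ} {B : ℝ} (hf : ∀ x, |f x| ≤ B) (y : E)
    [∀ z, Decidable (z = y)] :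
    ∫ z, f z * (if z = y then 0 else 1) ∂ν = ∫ z, f z ∂ν - ν.real {y} * f y := by
  have h1 : ∫ z, Set.indicator {y} (fun _ => f y) z ∂ν = ν.real {y} * f y := by
    rw [integral_indicator (measurableSet_singleton y), setIntegral_const, smul_eq_mul]
  rw [← h1, ← integral_sub (integrable_of_abs_le ν hf)
    ((integrable_const _).indicator (measurableSet_singleton y))]
  congr with z
  by_cases hz : z = y
  · simp [hz]
  · simp [hz]

/-- A function of the sample that does not decrease when an observation is replaced by `y` is
negatively correlated with the event that `y` is not observed. -/
lemma integral_mul_unseen_le (y : E) : ∀ {n : ℕ} {f : (Fin n → E) → ℝ} {B : ℝ},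
    (∀ x, |f x| ≤ B) → (∀ x k, f x ≤ f (Function.update x k y)) →
    ∫ x, f x * unseen y x ∂(draws ν n) ≤ (1 - ν.real {y}) ^ n * ∫ x, f x ∂(draws ν n) := by
  classical
  have hp0 : 0 ≤ ν.real {y} := measureReal_nonneg
  have hp1 : ν.real {y} ≤ 1 := measureReal_le_one
  intro n
  induction n with
  | zero =>
    intro f B _ _
    simp [unseen]
  | succ n ih =>
    intro f B hB hf
    have hB' : ∀ x, |f x * unseen y x| ≤ B := by
      intro x
      rw [abs_mul, abs_of_nonneg (unseen_nonneg y x)]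
      exact (mul_le_of_le_one_right (abs_nonneg _) (unseen_le_one y x)).trans (hB x)
    rw [integral_draws_succ ν hB', integral_draws_succ ν hB]
    set g : (Fin n → E) → ℝ := fun x => ∫ z, f (Fin.cons z x : Fin (n + 1) → E) ∂ν with hg
    have hgB : ∀ x, |g x| ≤ B := fun x => abs_integral_le_of_abs_le ν fun y => hB _
    have hgm : ∀ x k, g x ≤ g (Function.update x k y) := by
      intro x k
      refine integral_mono (integrable_of_abs_le ν fun y => hB _)
        (integrable_of_abs_le ν fun y => hB _) fun z => ?_
      have := hf (Fin.cons z x : Fin (n + 1) → E) k.succ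
      rwa [← Fin.cons_update] at this
    have hstep : ∀ x, ∫ z, f (Fin.cons z x : Fin (n + 1) → E) *
        unseen y (Fin.cons z x : Fin (n + 1) → E) ∂ν ≤ (1 - ν.real {y}) * (g x * unseen y x) := by
      intro x
      have e1 : ∀ z, f (Fin.cons z x : Fin (n + 1) → E) *
          unseen y (Fin.cons z x : Fin (n + 1) → E) =
          (f (Fin.cons z x : Fin (n + 1) → E) * (if z = y then 0 else 1)) * unseen y x := by
        intro z
        rw [unseen_cons]
        ring
      simp_rw [e1]
      rw [integral_mul_const, integral_mul_ite_eq ν (fun z => hB _) y, ← mul_assoc]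
      refine mul_le_mul_of_nonneg_right ?_ (unseen_nonneg y x)
      -- The value of `f` at first coordinate `y` dominates the average `g x`, so discarding the
      -- atom at `y` leaves at most `(1 - ν.real {y}) * g x`.
      have h2 : g x ≤ f (Fin.cons y x : Fin (n + 1) → E) := by
        calc g x ≤ ∫ _, f (Fin.cons y x : Fin (n + 1) → E) ∂ν := by
              refine integral_mono (integrable_of_abs_le ν fun y => hB _)
                (integrable_const _) fun z => ?_
              have := hf (Fin.cons z x : Fin (n + 1) → E) 0
              rwa [Fin.update_cons_zero] at this
          _ = _ := by simp
      change g x - _ ≤ _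
      nlinarith
    calc _ ≤ ∫ x, (1 - ν.real {y}) * (g x * unseen y x) ∂(draws ν n) := by
          refine integral_mono ?_ ?_ hstep
          · exact integrable_of_abs_le _ fun x => abs_integral_le_of_abs_le ν fun z => hB' _
          · refine Integrable.const_mul (integrable_of_abs_le (B := B) _ fun x => ?_) _
            rw [abs_mul, abs_of_nonneg (unseen_nonneg y x)]
            exact (mul_le_of_le_one_right (abs_nonneg _) (unseen_le_one y x)).trans (hgB x)
      _ = (1 - ν.real {y}) * ∫ x, g x * unseen y x ∂(draws ν n) := integral_const_mul _ _
      _ ≤ (1 - ν.real {y}) * ((1 - ν.real {y}) ^ n * ∫ x, g x ∂(draws ν n)) := by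
          exact mul_le_mul_of_nonneg_left (ih hgB hgm) (by linarith)
      _ = _ := by ring

/-- Constant functions satisfy the monotonicity hypothesis with both signs, so the correlation
inequality becomes an equality. -/
lemma integral_unseen (y : E) (n : ℕ) :
    ∫ x, unseen y x ∂(draws ν n) = (1 - ν.real {y}) ^ n := by
  have h1 := integral_mul_unseen_le ν y (n := n) (f := fun _ => 1) (B := 1) (by simp) (by simp)
  have h2 := integral_mul_unseen_le ν y (n := n) (f := fun _ => -1) (B := 1) (by simp) (by simp)
  simp only [neg_mul, one_mul, integral_neg, integral_const, probReal_univ, smul_eq_mul,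
    mul_one, mul_neg] at h1 h2
  linarith

/-- The indicators that given items are not observed are negatively dependent. -/
lemma integral_prod_one_add_mul_unseen_le (n : ℕ) (F : Finset E) {a : E → ℝ}
    (ha : ∀ y, -1 ≤ a y) (hs : (∀ y, 0 ≤ a y) ∨ ∀ y, a y ≤ 0) :
    ∫ x, ∏ y ∈ F, (1 + a y * unseen y x) ∂(draws ν n) ≤
      ∏ y ∈ F, (1 + a y * (1 - ν.real {y}) ^ n) := by
  classical
  induction F using Finset.induction_on with
  | empty => simp
  | insert y F hy ih =>
    set f : (Fin n → E) → ℝ := fun x => ∏ y ∈ F, (1 + a y * unseen y x) with hf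
    have hB := fun x : Fin n → E => abs_prod_one_add_mul_unseen_le F a x
    change ∀ x, |f x| ≤ _ at hB
    have hfac : ∀ (x : Fin n → E) z, 0 ≤ 1 + a z * unseen z x := by
      intro x z
      nlinarith [ha z, unseen_nonneg z x, unseen_le_one z x]
    have hne : ∀ z ∈ F, z ≠ y := fun z hz h => hy (h ▸ hz)
    -- Replacing an observation by `y` can only make the other items less seen. This raises `f` if
    -- all `a` are nonnegative and lowers it if all are nonpositive; in both cases multiplying by `a
    -- y` restores the same direction.
    have hkey : a y * ∫ x, f x * unseen y x ∂(draws ν n) ≤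
        a y * ((1 - ν.real {y}) ^ n * ∫ x, f x ∂(draws ν n)) := by
      rcases hs with hs | hs
      · refine mul_le_mul_of_nonneg_left (integral_mul_unseen_le ν y hB fun x k => ?_) (hs y)
        refine Finset.prod_le_prod (fun z _ => hfac x z) fun z hz => ?_
        have := unseen_le_unseen_update (hne z hz) x k
        gcongr
        exact hs z
      · have := integral_mul_unseen_le ν y (f := fun x => -f x) (fun x => by
          rw [abs_neg]; exact hB x) fun x k => by
          rw [neg_le_neg_iff]
          refine Finset.prod_le_prod (fun z _ => hfac _ z) fun z hz => ?_
          have := unseen_le_unseen_update (hne z hz) x k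
          nlinarith [hs z]
        simp only [neg_mul, integral_neg, mul_neg, neg_le_neg_iff] at this
        exact mul_le_mul_of_nonpos_left this (hs y)
    have hq0 : 0 ≤ (1 - ν.real {y}) ^ n :=
      pow_nonneg (by linarith [measureReal_le_one (μ := ν) (s := {y})]) _
    have hq1 : (1 - ν.real {y}) ^ n ≤ 1 :=
      pow_le_one₀ (by linarith [measureReal_le_one (μ := ν) (s := {y})])
        (by linarith [measureReal_nonneg (μ := ν) (s := {y})])
    have hint : Integrable (fun x => f x * unseen y x) (draws ν n) := by
      refine integrable_of_abs_le (B := ∏ y ∈ F, (1 + |a y|)) _ fun x => ?_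
      rw [abs_mul, abs_of_nonneg (unseen_nonneg y x)]
      exact (mul_le_of_le_one_right (abs_nonneg _) (unseen_le_one y x)).trans (hB x)
    calc ∫ x, ∏ y ∈ insert y F, (1 + a y * unseen y x) ∂(draws ν n)
        = ∫ x, (f x + a y * (f x * unseen y x)) ∂(draws ν n) := by
          congr with x
          rw [Finset.prod_insert hy]
          ring
      _ = ∫ x, f x ∂(draws ν n) + a y * ∫ x, f x * unseen y x ∂(draws ν n) := by
          rw [integral_add (integrable_of_abs_le _ hB) (hint.const_mul _), integral_const_mul]
      _ ≤ (1 + a y * (1 - ν.real {y}) ^ n) * ∫ x, f x ∂(draws ν n) := by linarith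
      _ ≤ (1 + a y * (1 - ν.real {y}) ^ n) * ∏ y ∈ F, (1 + a y * (1 - ν.real {y}) ^ n) := by
          refine mul_le_mul_of_nonneg_left ih ?_
          nlinarith [ha y]
      _ = _ := by rw [Finset.prod_insert hy]

lemma exists_finset_measureReal_diff_le (A : Set E) {η : ℝ} (hη : 0 < η) :
    ∃ F : Finset E, ↑F ⊆ A ∧ ν.real (A \ ↑F) ≤ η := by
  have h1 : HasSum (fun x : A => ν.real {(x : E)}) (ν.real A) := by
    have h2 : ∑' x : A, ν {(x : E)} = ν A := by
      have := measure_biUnion (μ := ν) (Set.to_countable A) (f := fun x => {x})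
        (fun x _ y _ h => by simpa using h) (fun x _ => measurableSet_singleton x)
      rw [← this, Set.biUnion_of_singleton]
    rw [Measure.real, ← h2, ENNReal.tsum_toReal_eq fun x => measure_ne_top _ _]
    exact (ENNReal.summable_toReal (by rw [h2]; exact measure_ne_top _ _)).hasSum
  obtain ⟨F, hF⟩ := ((tendsto_order.1 h1).1 (ν.real A - η) (by linarith)).exists
  refine ⟨F.map (Function.Embedding.subtype _), ?_, ?_⟩
  · intro x hx
    simp at hx
    exact hx.1
  · have h3 : ν.real (↑(F.map (Function.Embedding.subtype fun x => x ∈ A)) : Set E)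
        = ∑ x ∈ F, ν.real {(x : E)} := by
      rw [← sum_measureReal_singleton, Finset.sum_map]
      rfl
    rw [measureReal_sdiff _ (Finset.measurableSet _), h3]
    · linarith
    · intro x hx
      simp at hx
      exact hx.1

omit [Countable E] in
lemma measureReal_diff_range_eq_sum {n : ℕ} (F : Finset E) (x : Fin n → E) :
    ν.real (↑F \ Set.range x) = ∑ y ∈ F, ν.real {y} * unseen y x := by
  classical
  have h : (↑F \ Set.range x : Set E) = ↑(F.filter fun y => y ∉ Set.range x) := by
    ext y; simp
  rw [h, ← sum_measureReal_singleton, Finset.sum_filter]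
  refine Finset.sum_congr rfl fun y _ => ?_
  unfold unseen
  by_cases hy : y ∈ Set.range x <;> simp [hy]

omit [Countable E] [MeasurableSingletonClass E] in
lemma abs_measureReal_le_one (s : Set E) : |ν.real s| ≤ 1 := by
  rw [abs_of_nonneg measureReal_nonneg]
  exact measureReal_le_one

omit [Countable E] [MeasurableSingletonClass E] in
lemma abs_exp_mul_measureReal_le (l : ℝ) (s : Set E) : |exp (l * ν.real s)| ≤ exp |l| := by
  rw [abs_of_pos (exp_pos _), exp_le_exp]
  calc l * ν.real s ≤ |l * ν.real s| := le_abs_self _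
    _ = |l| * |ν.real s| := abs_mul _ _
    _ ≤ |l| * 1 := by gcongr; exact abs_measureReal_le_one ν s
    _ = _ := mul_one _

/-- An exponential of a multiple of an indicator is affine in the indicator, so the exponential of
the mass is a product to which negative dependence applies. The coefficients `exp(l p) - 1` all have
the sign of `l`. -/
lemma integral_exp_missingMass_finset_le {n : ℕ} (hn : n ≠ 0) (F : Finset E) (l : ℝ) :
    ∫ x, exp (l * ν.real (↑F \ Set.range x)) ∂(draws ν n) ≤
      exp (l * ∫ x, ν.real (↑F \ Set.range x) ∂(draws ν n)) * exp (1 / n * l ^ 2 / 2) := by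
  have hint : ∀ y, Integrable (fun x => ν.real {y} * unseen y x) (draws ν n) := by
    intro y
    refine (integrable_of_abs_le (B := 1) _ fun x => ?_).const_mul _
    rw [abs_of_nonneg (unseen_nonneg y x)]
    exact unseen_le_one y x
  have hmean : ∫ x, ν.real (↑F \ Set.range x) ∂(draws ν n) =
      ∑ y ∈ F, ν.real {y} * (1 - ν.real {y}) ^ n := by
    simp_rw [measureReal_diff_range_eq_sum]
    rw [integral_finsetSum _ fun y _ => hint y]
    simp_rw [integral_const_mul, integral_unseen]
  have hexp : ∀ x : Fin n → E, exp (l * ν.real (↑F \ Set.range x)) =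
      ∏ y ∈ F, (1 + (exp (l * ν.real {y}) - 1) * unseen y x) := by
    intro x
    rw [measureReal_diff_range_eq_sum, Finset.mul_sum, exp_sum]
    refine Finset.prod_congr rfl fun y _ => ?_
    unfold unseen
    split_ifs <;> simp
  have hsum : ∑ y ∈ F, ν.real {y} ≤ 1 := by
    rw [sum_measureReal_singleton]
    exact measureReal_le_one
  simp_rw [hexp]
  calc _ ≤ ∏ y ∈ F, (1 + (exp (l * ν.real {y}) - 1) * (1 - ν.real {y}) ^ n) := by
        refine integral_prod_one_add_mul_unseen_le ν n F
          (a := fun y => exp (l * ν.real {y}) - 1)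
          (fun y => by linarith [exp_pos (l * ν.real {y})]) ?_
        rcases le_total 0 l with hl | hl
        · left; intro y
          have := one_le_exp (mul_nonneg hl (measureReal_nonneg (μ := ν) (s := {y})))
          linarith
        · right; intro y
          have := exp_le_one_iff.2
            (mul_nonpos_of_nonpos_of_nonneg hl (measureReal_nonneg (μ := ν) (s := {y})))
          linarith
    _ ≤ ∏ y ∈ F, exp (l * (ν.real {y} * (1 - ν.real {y}) ^ n) +
          ν.real {y} * (1 / n * l ^ 2 / 2)) := by
        refine Finset.prod_le_prod (fun y _ => ?_) fun y _ =>
          one_add_exp_sub_one_mul_one_sub_pow_le measureReal_nonneg measureReal_le_one hn l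
        have h0 : (1 - ν.real {y}) ^ n ≤ 1 :=
          pow_le_one₀ (by linarith [measureReal_le_one (μ := ν) (s := {y})])
            (by linarith [measureReal_nonneg (μ := ν) (s := {y})])
        have h1 : 0 ≤ (1 - ν.real {y}) ^ n :=
          pow_nonneg (by linarith [measureReal_le_one (μ := ν) (s := {y})]) _
        nlinarith [exp_pos (l * ν.real {y})]
    _ = exp (l * ∑ y ∈ F, ν.real {y} * (1 - ν.real {y}) ^ n +
          (∑ y ∈ F, ν.real {y}) * (1 / n * l ^ 2 / 2)) := by
        rw [← exp_sum, Finset.sum_add_distrib, Finset.mul_sum, Finset.sum_mul]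
    _ ≤ exp (l * ∑ y ∈ F, ν.real {y} * (1 - ν.real {y}) ^ n + 1 * (1 / n * l ^ 2 / 2)) := by
        gcongr
    _ = _ := by rw [exp_add, one_mul, hmean]

/-- Finite subsets of `A` of nearly full mass approximate the missing mass uniformly in the sample;
let the error `η` tend to 0. -/
lemma integral_exp_missingMass_le {n : ℕ} (hn : n ≠ 0) (A : Set E) (l : ℝ) :
    ∫ x, exp (l * ν.real (A \ Set.range x)) ∂(draws ν n) ≤
      exp (l * ∫ x, ν.real (A \ Set.range x) ∂(draws ν n)) * exp (1 / n * l ^ 2 / 2) := by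
  set m := ∫ x, ν.real (A \ Set.range x) ∂(draws ν n) with hm
  have happrox : ∀ η : ℝ, 0 < η → ∫ x, exp (l * ν.real (A \ Set.range x)) ∂(draws ν n) ≤
      exp (2 * |l| * η) * (exp (l * m) * exp (1 / n * l ^ 2 / 2)) := by
    intro η hη
    obtain ⟨F, hFA, hF⟩ := exists_finset_measureReal_diff_le ν A hη
    have hle : ∀ x : Fin n → E, |ν.real (A \ Set.range x) - ν.real (↑F \ Set.range x)| ≤ η := by
      intro x
      rw [abs_of_nonneg (sub_nonneg.2 (measureReal_mono (Set.sdiff_subset_sdiff_left hFA)))]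
      have : A \ Set.range x ⊆ (↑F \ Set.range x) ∪ (A \ ↑F) := by
        intro y hy
        by_cases hyF : y ∈ (F : Set E)
        · exact Or.inl ⟨hyF, hy.2⟩
        · exact Or.inr ⟨hy.1, hyF⟩
      have h1 := (measureReal_mono (μ := ν) this).trans (measureReal_union_le _ _)
      linarith
    have hlmul : ∀ a b : ℝ, |a - b| ≤ η → l * a ≤ |l| * η + l * b := by
      intro a b hab
      have h1 : l * (a - b) ≤ |l| * η := (le_abs_self _).trans (by rw [abs_mul]; gcongr)
      linarith
    have hmle : |(∫ x, ν.real (↑F \ Set.range x) ∂(draws ν n)) - m| ≤ η := by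
      rw [hm, ← integral_sub (integrable_of_abs_le _ fun x => abs_measureReal_le_one ν _)
        (integrable_of_abs_le _ fun x => abs_measureReal_le_one ν _)]
      refine abs_integral_le_of_abs_le _ fun x => ?_
      rw [abs_sub_comm]
      exact hle x
    calc _ ≤ ∫ x, exp (|l| * η) * exp (l * ν.real (↑F \ Set.range x)) ∂(draws ν n) := by
          refine integral_mono
            (integrable_of_abs_le _ fun x => abs_exp_mul_measureReal_le ν l _)
            ((integrable_of_abs_le _ fun x => abs_exp_mul_measureReal_le ν l _).const_mul _)
            fun x => ?_
          simp only
          rw [← exp_add, exp_le_exp]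
          exact hlmul _ _ (hle x)
      _ = exp (|l| * η) * ∫ x, exp (l * ν.real (↑F \ Set.range x)) ∂(draws ν n) :=
          integral_const_mul _ _
      _ ≤ exp (|l| * η) * (exp (l * ∫ x, ν.real (↑F \ Set.range x) ∂(draws ν n)) *
            exp (1 / n * l ^ 2 / 2)) := by
          gcongr
          exact integral_exp_missingMass_finset_le ν hn F l
      _ ≤ exp (|l| * η) * (exp (|l| * η + l * m) * exp (1 / n * l ^ 2 / 2)) := by
          gcongr
          exact hlmul _ _ hmle
      _ = _ := by
          rw [← exp_add, ← exp_add, ← exp_add, ← exp_add]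
          ring_nf
  have hlim : Filter.Tendsto (fun η : ℝ => exp (2 * |l| * η) *
      (exp (l * m) * exp (1 / n * l ^ 2 / 2))) (nhdsWithin 0 (Set.Ioi 0))
      (nhds (exp (2 * |l| * 0) * (exp (l * m) * exp (1 / n * l ^ 2 / 2)))) := by
    refine Filter.Tendsto.mono_left (Continuous.tendsto ?_ 0) nhdsWithin_le_nhds
    fun_prop
  have := ge_of_tendsto hlim (Filter.eventually_of_mem self_mem_nhdsWithin happrox)
  simpa using this

/-- The missing mass of a set after `n` draws concentrates with variance proxy `1 / n`. -/
lemma hasSubgaussianMGF_missingMass {n : ℕ} (hn : n ≠ 0) (A : Set E) :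
    HasSubgaussianMGF (fun x => ν.real (A \ Set.range x) -
      ∫ y, ν.real (A \ Set.range y) ∂(draws ν n)) (1 / n) (draws ν n) := by
  refine hasSubgaussianMGF_of_integral_exp_le _ (fun x => abs_measureReal_le_one ν _) fun l => ?_
  simpa using integral_exp_missingMass_le ν hn A l

end MissingMass

end Discovery

namespace Discovery

open Real NNReal

/-! ### Bias and concentration of the Good-Turing estimator. -/

section GoodTuring

variable {E : Type*}

/-- The number of elements of `A` that occur exactly once in the sample `x`. -/
noncomputable def singletons (A : Set E) {n : ℕ} (x : Fin n → E) : ℕ :=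
  {y | y ∈ A ∧ ∃! k, x k = y}.ncard

lemma finite_singletons (A : Set E) {n : ℕ} (x : Fin n → E) :
    {y | y ∈ A ∧ ∃! k, x k = y}.Finite := by
  refine (Set.finite_range x).subset ?_
  rintro y ⟨_, k, hk, _⟩
  exact ⟨k, hk⟩

/-- Only the old and the new value of the changed coordinate can alter their status. -/
lemma singletons_update_le (A : Set E) {n : ℕ} (x : Fin n → E) (k : Fin n) (z : E) :
    singletons A (Function.update x k z) ≤ singletons A x + 2 := by
  have hsub : {y | y ∈ A ∧ ∃! j, Function.update x k z j = y} ⊆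
      {y | y ∈ A ∧ ∃! j, x j = y} ∪ {z, x k} := by
    rintro y ⟨hyA, hy⟩
    by_cases hyz : y = z
    · right; simp [hyz]
    by_cases hyk : y = x k
    · right; simp [hyk]
    left
    refine ⟨hyA, ?_⟩
    have : ∀ j, Function.update x k z j = y ↔ x j = y := by
      intro j
      by_cases hj : j = k
      · subst hj
        simp [Ne.symm hyz, Ne.symm hyk]
      · rw [Function.update_of_ne hj]
    simpa only [this] using hy
  calc _ ≤ ({y | y ∈ A ∧ ∃! j, x j = y} ∪ {z, x k}).ncard :=
        Set.ncard_le_ncard hsub ((finite_singletons A x).union (Set.toFinite _))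
    _ ≤ _ := Set.ncard_union_le _ _
    _ ≤ _ := Nat.add_le_add_left ((Set.ncard_insert_le _ _).trans (by simp)) _

lemma abs_singletons_update_sub_le (A : Set E) {n : ℕ} (x : Fin n → E) (k : Fin n) (z : E) :
    |(singletons A (Function.update x k z) : ℝ) - singletons A x| ≤ 2 := by
  have h1 : (singletons A (Function.update x k z) : ℝ) ≤ singletons A x + 2 := by
    exact_mod_cast singletons_update_le A x k z
  have h2 : (singletons A x : ℝ) ≤ singletons A (Function.update x k z) + 2 := by
    have := singletons_update_le A (Function.update x k z) k (x k)
    rw [Function.update_idem, Function.update_eq_self] at this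
    exact_mod_cast this
  rw [abs_le]
  constructor <;> linarith

/-- Leave-one-out form: a singleton corresponds to the unique draw that is unseen in the `n` other
draws. By exchangeability, `singletons / (n + 1)` has the mean of the missing mass after `n` draws.
-/
lemma singletons_eq_sum (A : Set E) {n : ℕ} (x : Fin (n + 1) → E) :
    (singletons A x : ℝ) =
      ∑ k, A.indicator (fun y => unseen y (fun j => x (k.succAbove j))) (x k) := by
  classical
  have himg : {y | y ∈ A ∧ ∃! k, x k = y} =
      x '' {k | x k ∈ A ∧ x k ∉ Set.range fun j => x (k.succAbove j)} := by
    ext y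
    constructor
    · rintro ⟨hy, k, rfl, hk⟩
      refine ⟨k, ⟨hy, ?_⟩, rfl⟩
      rintro ⟨j, hj⟩
      exact Fin.succAbove_ne k j (hk _ hj)
    · rintro ⟨k, ⟨hkA, hk⟩, rfl⟩
      refine ⟨hkA, k, rfl, fun j hj => ?_⟩
      by_contra hne
      obtain ⟨i, rfl⟩ := Fin.exists_succAbove_eq hne
      exact hk ⟨i, hj⟩
  have hinj : Set.InjOn x {k | x k ∈ A ∧ x k ∉ Set.range fun j => x (k.succAbove j)} := by
    rintro k ⟨_, hk⟩ l _ hkl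
    by_contra hne
    obtain ⟨i, rfl⟩ := Fin.exists_succAbove_eq (Ne.symm hne)
    exact hk ⟨i, hkl.symm⟩
  rw [singletons, himg, hinj.ncard_image, Set.ncard_eq_toFinset_card',
    Set.toFinset_ofPred, Finset.card_filter]
  push_cast
  refine Finset.sum_congr rfl fun k _ => ?_
  unfold unseen
  by_cases h1 : x k ∈ A
  · by_cases h2 : x k ∈ Set.range fun j => x (k.succAbove j)
    · rw [Set.indicator_of_mem h1, if_pos h2, if_neg fun h => h.2 h2]
    · rw [Set.indicator_of_mem h1, if_neg h2, if_pos ⟨h1, h2⟩]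
  · rw [Set.indicator_of_notMem h1, if_neg fun h => h1 h.1]

variable [Countable E] [MeasurableSpace E] [MeasurableSingletonClass E]
variable (ν : Measure E) [IsProbabilityMeasure ν]

omit [Countable E] [MeasurableSpace E] [MeasurableSingletonClass E] in
lemma abs_indicator_unseen_le (A : Set E) {n : ℕ} (y : E) (x : Fin n → E) :
    |A.indicator (fun y => unseen y x) y| ≤ 1 := by
  by_cases h : y ∈ A
  · rw [Set.indicator_of_mem h, abs_of_nonneg (unseen_nonneg y x)]
    exact unseen_le_one y x
  · rw [Set.indicator_of_notMem h]
    simp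

lemma integral_indicator_unseen (A : Set E) (n : ℕ) (y : E) :
    ∫ x, A.indicator (fun y => unseen y x) y ∂(draws ν n) =
      A.indicator (fun y => (1 - ν.real {y}) ^ n) y := by
  by_cases h : y ∈ A
  · simp only [Set.indicator_of_mem h, integral_unseen]
  · simp only [Set.indicator_of_notMem h, integral_zero]

lemma integral_singletons (A : Set E) (n : ℕ) :
    ∫ x, (singletons A x : ℝ) ∂(draws ν (n + 1)) =
      (n + 1) * ∫ y, A.indicator (fun y => (1 - ν.real {y}) ^ n) y ∂ν := by
  simp_rw [singletons_eq_sum]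
  rw [integral_finsetSum _ fun k _ =>
    integrable_of_abs_le (B := 1) _ fun x => abs_indicator_unseen_le A _ _]
  have hk : ∀ k : Fin (n + 1), ∫ x, A.indicator
      (fun y => unseen y (fun j => x (k.succAbove j))) (x k) ∂(draws ν (n + 1)) =
      ∫ y, A.indicator (fun y => (1 - ν.real {y}) ^ n) y ∂ν := by
    intro k
    have h := measurePreserving_piFinSuccAbove (fun _ : Fin (n + 1) => ν) k
    have h2 := h.integral_comp' (fun p : E × (Fin n → E) =>
      A.indicator (fun y => unseen y p.2) p.1)
    rw [integral_prod _ (integrable_of_abs_le (B := 1) _ fun p =>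
      abs_indicator_unseen_le A _ _)] at h2
    simp only [integral_indicator_unseen] at h2
    exact h2
  simp [hk]

lemma integral_missingMass (A : Set E) (n : ℕ) :
    ∫ x, ν.real (A \ Set.range x) ∂(draws ν n) =
      ∫ y, A.indicator (fun y => (1 - ν.real {y}) ^ n) y ∂ν := by
  have h : ∀ x : Fin n → E, ν.real (A \ Set.range x) =
      ∫ y, A.indicator (fun y => unseen y x) y ∂ν := by
    intro x
    rw [← integral_indicator_one (Set.to_countable _).measurableSet]
    congr with y
    unfold unseen
    by_cases h1 : y ∈ A
    · by_cases h2 : y ∈ Set.range x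
      · rw [Set.indicator_of_mem h1, if_pos h2, Set.indicator_of_notMem fun h => h.2 h2]
      · rw [Set.indicator_of_mem h1, if_neg h2,
          Set.indicator_of_mem (show y ∈ A \ Set.range x from ⟨h1, h2⟩)]
        rfl
    · rw [Set.indicator_of_notMem h1, Set.indicator_of_notMem fun h => h1 h.1]
  simp_rw [h]
  rw [integral_integral_swap]
  · simp only [integral_indicator_unseen]
  · exact integrable_of_abs_le (B := 1) _ fun p => abs_indicator_unseen_le A _ _

/-- `(1-p)^n` is the least of `n + 1` geometric terms, whose sum times `p` is `1 - (1-p)^(n+1)`. It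
bounds the mean mass lost in one further draw, which is the bias. -/
lemma natCast_mul_mul_one_sub_pow_le {p : ℝ} (h0 : 0 ≤ p) (h1 : p ≤ 1) (n : ℕ) :
    (n + 1) * (p * (1 - p) ^ n) ≤ 1 := by
  have hs : (n + 1) * (1 - p) ^ n ≤ ∑ k ∈ Finset.range (n + 1), (1 - p) ^ k := by
    have := Finset.card_nsmul_le_sum (Finset.range (n + 1)) (fun k => (1 - p) ^ k) ((1 - p) ^ n)
      fun k hk => pow_le_pow_of_le_one (by linarith) (by linarith)
        (Nat.lt_succ_iff.1 (Finset.mem_range.1 hk))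
    simpa using this
  have hg := mul_neg_geom_sum (1 - p) (n + 1)
  have h2 : 0 ≤ (1 - p) ^ (n + 1) := pow_nonneg (by linarith) _
  rw [sub_sub_cancel] at hg
  nlinarith

/-- The bias of the Good-Turing estimator. -/
lemma bias_goodTuring (A : Set E) {n : ℕ} (hn : n ≠ 0) :
    ∫ x, ν.real (A \ Set.range x) ∂(draws ν n) ≤ (∫ x, (singletons A x : ℝ) ∂(draws ν n)) / n ∧
    (∫ x, (singletons A x : ℝ) ∂(draws ν n)) / n ≤
      ∫ x, ν.real (A \ Set.range x) ∂(draws ν n) + 1 / n := by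
  obtain ⟨m, rfl⟩ := Nat.exists_eq_succ_of_ne_zero hn
  rw [Nat.succ_eq_add_one, integral_missingMass, integral_singletons]
  push_cast
  rw [mul_div_cancel_left₀ _ (by positivity : (m : ℝ) + 1 ≠ 0)]
  have hp0 : ∀ y, 0 ≤ ν.real {y} := fun y => measureReal_nonneg
  have hp1 : ∀ y, 0 ≤ 1 - ν.real {y} := fun y => sub_nonneg.2 measureReal_le_one
  have hint : ∀ k, Integrable (A.indicator fun y => (1 - ν.real {y}) ^ k) ν := by
    intro k
    refine integrable_of_abs_le (B := 1) _ fun y => ?_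
    by_cases h : y ∈ A
    · rw [Set.indicator_of_mem h, abs_of_nonneg (pow_nonneg (hp1 y) _)]
      exact pow_le_one₀ (hp1 y) (by linarith [hp0 y])
    · rw [Set.indicator_of_notMem h]; simp
  constructor
  · refine integral_mono (hint _) (hint _) fun y => ?_
    refine Set.indicator_le_indicator ?_
    exact pow_le_pow_of_le_one (hp1 y) (by linarith [hp0 y]) (Nat.le_succ m)
  · have : (1 : ℝ) / (m + 1) = ∫ _, (1 : ℝ) / (m + 1) ∂ν := by simp
    rw [this, ← integral_add (hint _) (integrable_const _)]
    refine integral_mono (hint _) ((hint _).add (integrable_const _)) fun y => ?_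
    simp only
    by_cases h : y ∈ A
    · rw [Set.indicator_of_mem h, Set.indicator_of_mem h, ← sub_le_iff_le_add',
        le_div_iff₀ (by positivity)]
      have := natCast_mul_mul_one_sub_pow_le (hp0 y) (by linarith [hp1 y]) m
      rw [pow_succ]
      linarith
    · rw [Set.indicator_of_notMem h, Set.indicator_of_notMem h]
      positivity

/-- Differences of size 2 give McDiarmid's proxy `n * 2² / 4 = n`, which scales to `n / n² = 1/n`.
-/
lemma hasSubgaussianMGF_singletons_div {n : ℕ} (hn : n ≠ 0) (A : Set E) :
    HasSubgaussianMGF (fun x => (1 / n : ℝ) * ((singletons A x : ℝ) -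
      ∫ y, (singletons A y : ℝ) ∂(draws ν n))) (1 / n) (draws ν n) := by
  have h := (hasSubgaussianMGF_of_bounded_differences ν (c := 2)
    (f := fun x : Fin n → E => (singletons A x : ℝ))
    fun x k y => by
      rw [NNReal.coe_ofNat]
      exact abs_singletons_update_sub_le A (n := n) x k y).const_mul (1 / n : ℝ)
  convert h using 1
  ext
  have : (n : ℝ) ≠ 0 := by exact_mod_cast hn
  push_cast
  change (1 / n : ℝ) = (1 / n : ℝ) ^ 2 * _
  field_simp
  norm_num

lemma hasSubgaussianMGF_missingMass_sub {n : ℕ} (hn : n ≠ 0) (A : Set E) :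
    HasSubgaussianMGF (fun x => (ν.real (A \ Set.range x) -
      ∫ y, ν.real (A \ Set.range y) ∂(draws ν n)) + -((1 / n : ℝ) * ((singletons A x : ℝ) -
      ∫ y, (singletons A y : ℝ) ∂(draws ν n)))) (4 / n) (draws ν n) := by
  have h := (hasSubgaussianMGF_missingMass ν hn A).add
    (hasSubgaussianMGF_singletons_div ν hn A).neg
  -- The two terms depend on the same sample, so square roots of the proxies add.
  have hc : (NNReal.sqrt (1 / n) + NNReal.sqrt (1 / n)) ^ 2 = (4 / n : ℝ≥0) := by
    rw [← two_mul, mul_pow, NNReal.sq_sqrt]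
    ring
  rw [hc] at h
  exact h

lemma exp_deviation_eq {n : ℕ} (hn : n ≠ 0) {L : ℝ} (hL : 0 ≤ L) :
    exp (-(4 * √(L / n)) ^ 2 / (2 * (4 / n : ℝ≥0))) = exp (-2 * L) := by
  have : (n : ℝ) ≠ 0 := by exact_mod_cast hn
  rw [mul_pow, sq_sqrt (by positivity)]
  push_cast
  congr 1
  field_simp
  ring

lemma measureReal_goodTuring_add_le_missingMass {n : ℕ} (hn : n ≠ 0) (A : Set E) {L : ℝ}
    (hL : 0 ≤ L) :
    (draws ν n).real {x | (singletons A x : ℝ) / n + 4 * √(L / n) ≤ ν.real (A \ Set.range x)} ≤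
      exp (-2 * L) := by
  have h := (hasSubgaussianMGF_missingMass_sub ν hn A).measure_ge_le
    (ε := 4 * √(L / n)) (by positivity)
  rw [exp_deviation_eq hn hL] at h
  refine le_trans (measureReal_mono fun x hx => ?_) h
  have hb := (bias_goodTuring ν A hn).1
  simp only [Set.mem_ofPred_eq] at hx ⊢
  rw [div_eq_mul_one_div, mul_comm] at hx hb
  linarith

lemma measureReal_missingMass_add_le_goodTuring {n : ℕ} (hn : n ≠ 0) (A : Set E) {L : ℝ}
    (hL : 0 ≤ L) :
    (draws ν n).real {x | ν.real (A \ Set.range x) + 1 / n + 4 * √(L / n) ≤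
      (singletons A x : ℝ) / n} ≤ exp (-2 * L) := by
  have h := (hasSubgaussianMGF_missingMass_sub ν hn A).neg.measure_ge_le
    (ε := 4 * √(L / n)) (by positivity)
  rw [exp_deviation_eq hn hL] at h
  refine le_trans (measureReal_mono fun x hx => ?_) h
  have hb := (bias_goodTuring ν A hn).2
  simp only [Set.mem_ofPred_eq, Pi.neg_apply] at hx ⊢
  rw [div_eq_mul_one_div (singletons A x : ℝ), mul_comm (singletons A x : ℝ)] at hx
  rw [div_eq_mul_one_div (∫ x, (singletons A x : ℝ) ∂(draws ν n)),
    mul_comm (∫ x, (singletons A x : ℝ) ∂(draws ν n))] at hb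
  linarith

end GoodTuring

end Discovery

namespace Discovery

/-! ### Deterministic properties of runs, of the oracle and of Good-UCB. -/

section Runs

variable {K : ℕ} {E : Type*}

lemma pulls_cons (h : History K E) (j i : Fin K) (y : E) :
    pulls ((j, y) :: h) i = pulls h i + if j = i then 1 else 0 := by
  simp [pulls, List.countP_cons]

lemma sum_pulls (h : History K E) : ∑ i, pulls h i = h.length := by
  induction h with
  | nil => simp [pulls]
  | cons p h ih =>
    obtain ⟨j, y⟩ := p
    simp [pulls_cons, Finset.sum_add_distrib, ih]

lemma pulls_le_length (h : History K E) (i : Fin K) : pulls h i ≤ h.length :=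
  List.countP_le_length

lemma length_run (π : Policy K E) (x : Fin K → ℕ → E) (t : ℕ) : (run π x t).length = t := by
  induction t with
  | zero => rfl
  | succ t ih => simp [run, ih]

lemma pulls_run_succ (π : Policy K E) (x : Fin K → ℕ → E) (t : ℕ) (i : Fin K) :
    pulls (run π x (t + 1)) i =
      pulls (run π x t) i + if π (run π x t) = i then 1 else 0 := by
  rw [run, pulls_cons]

lemma pulls_run_mono (π : Policy K E) (x : Fin K → ℕ → E) (i : Fin K) :
    Monotone fun t => pulls (run π x t) i := by
  refine monotone_nat_of_le_succ fun t => ?_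
  rw [pulls_run_succ]
  exact Nat.le_add_right _ _

lemma mem_run_iff (π : Policy K E) (x : Fin K → ℕ → E) (t : ℕ) (i : Fin K) (y : E) :
    (i, y) ∈ run π x t ↔ ∃ m < pulls (run π x t) i, x i m = y := by
  induction t with
  | zero => simp [run, pulls]
  | succ t ih =>
    rw [pulls_run_succ, run, List.mem_cons, ih, Prod.mk.injEq]
    by_cases h : π (run π x t) = i
    · rw [if_pos h]
      constructor
      · rintro (⟨_, rfl⟩ | ⟨m, hm, rfl⟩)
        · exact ⟨pulls (run π x t) i, Nat.lt_succ_self _, by rw [h]⟩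
        · exact ⟨m, Nat.lt_succ_of_lt hm, rfl⟩
      · rintro ⟨m, hm, rfl⟩
        rcases Nat.lt_succ_iff_lt_or_eq.1 hm with hm | rfl
        · exact Or.inr ⟨m, hm, rfl⟩
        · exact Or.inl ⟨h.symm, by rw [h]⟩
    · rw [if_neg h, add_zero]
      simp [Ne.symm h]

lemma occ_run (π : Policy K E) (x : Fin K → ℕ → E) (t : ℕ) (i : Fin K) (y : E)
    [∀ m, Decidable (x i m = y)] :
    occ (run π x t) i y =
      ((Finset.range (pulls (run π x t) i)).filter fun m => x i m = y).card := by
  classical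
  induction t with
  | zero => simp [run, pulls, occ]
  | succ t ih =>
    rw [pulls_run_succ, run, occ, List.countP_cons]
    change occ (run π x t) i y + _ = _
    rw [ih]
    by_cases h : π (run π x t) = i
    · rw [if_pos h, Finset.range_add_one, Finset.filter_insert]
      subst h
      by_cases hy : x (π (run π x t)) (pulls (run π x t) (π (run π x t))) = y
      · rw [if_pos hy, Finset.card_insert_of_notMem (by simp)]
        simp [hy]
      · rw [if_neg hy]
        simp [hy]
    · simp [h]

/-- The successive requests to expert `i` meet the counts `0, 1, …` once each, so the sum regroups
by expert. -/
lemma sum_run_eq (π : Policy K E) (x : Fin K → ℕ → E) (g : ℕ → ℝ) (t : ℕ) :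
    ∑ s ∈ Finset.range t, g (pulls (run π x s) (π (run π x s))) =
      ∑ i, ∑ m ∈ Finset.range (pulls (run π x t) i), g m := by
  induction t with
  | zero => simp [run, pulls]
  | succ t ih =>
    rw [Finset.sum_range_succ, ih]
    have h : ∀ i, ∑ m ∈ Finset.range (pulls (run π x (t + 1)) i), g m =
        ∑ m ∈ Finset.range (pulls (run π x t) i), g m +
          if π (run π x t) = i then g (pulls (run π x t) (π (run π x t))) else 0 := by
      intro i
      rw [pulls_run_succ]
      split_ifs with hi
      · rw [Finset.sum_range_succ, hi]
      · simp
    simp_rw [h]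
    rw [Finset.sum_add_distrib, Finset.sum_ite_eq]
    simp

variable [MeasurableSpace E]

/-- The missing mass of expert `i` once it has given the answers `x i 0, …, x i (n - 1)`. -/
noncomputable def massAfter (A : Set E) (P : Fin K → Measure E) (x : Fin K → ℕ → E) (i : Fin K)
    (n : ℕ) : ℝ :=
  (P i).real (A \ Set.range fun k : Fin n => x i k)

lemma missingMass_run (A : Set E) (P : Fin K → Measure E) (π : Policy K E) (x : Fin K → ℕ → E)
    (t : ℕ) (i : Fin K) :
    missingMass A P (run π x t) i = massAfter A P x i (pulls (run π x t) i) := by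
  have h : {y | (i, y) ∈ run π x t} = Set.range fun k : Fin (pulls (run π x t) i) => x i k := by
    ext y
    change (i, y) ∈ run π x t ↔ _
    rw [mem_run_iff]
    constructor
    · rintro ⟨m, hm, rfl⟩
      exact ⟨⟨m, hm⟩, rfl⟩
    · rintro ⟨m, rfl⟩
      exact ⟨m, m.2, rfl⟩
  rw [missingMass, massAfter, h]

lemma massAfter_antitone (A : Set E) (P : Fin K → Measure E) [∀ i, IsProbabilityMeasure (P i)]
    (x : Fin K → ℕ → E) (i : Fin K) : Antitone (massAfter A P x i) := by
  intro m n hmn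
  refine measureReal_mono (Set.sdiff_subset_sdiff_right ?_)
  rintro _ ⟨k, rfl⟩
  exact ⟨⟨k, k.2.trans_le hmn⟩, rfl⟩

section Oracle

variable {A : Set E} {P : Fin K → Measure E} [∀ i, IsProbabilityMeasure (P i)] {π : Policy K E}

/-- The maximal missing mass decreases along the oracle's run, and it equalled `massAfter A P x i n`
when request number `n + 1` was made to `i`. -/
lemma IsOCL.le_massAfter_of_lt_pulls (hπ : IsOCL A P π) (x : Fin K → ℕ → E) (t : ℕ) (i : Fin K)
    (n : ℕ) (hn : n < pulls (run π x t) i) :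
    massAfter A P x (π (run π x t)) (pulls (run π x t) (π (run π x t))) ≤ massAfter A P x i n := by
  have hmax : ∀ s j, massAfter A P x j (pulls (run π x s) j) ≤
      massAfter A P x (π (run π x s)) (pulls (run π x s) (π (run π x s))) := by
    intro s j
    rw [← missingMass_run, ← missingMass_run]
    exact hπ _ _
  induction t with
  | zero => simp [run, pulls] at hn
  | succ t ih =>
    have hle : massAfter A P x (π (run π x (t + 1)))
        (pulls (run π x (t + 1)) (π (run π x (t + 1)))) ≤
        massAfter A P x (π (run π x t)) (pulls (run π x t) (π (run π x t))) :=
      (massAfter_antitone A P x _ (pulls_run_mono π x _ (Nat.le_succ t))).trans (hmax t _)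
    rcases lt_or_ge n (pulls (run π x t) i) with h | h
    · exact hle.trans (ih h)
    · rw [pulls_run_succ] at hn
      split_ifs at hn with hi
      · obtain rfl : n = pulls (run π x t) i := by omega
        rw [← hi]
        rw [hi] at hle ⊢
        exact hle
      · omega

/-- At each time, the oracle's current missing mass is dominated by that of some expert along any
other policy. -/
lemma IsOCL.exists_missingMass_le (hπ : IsOCL A P π) (π' : Policy K E) (x : Fin K → ℕ → E)
    (t : ℕ) :
    ∃ i, missingMass A P (run π x t) (π (run π x t)) ≤ missingMass A P (run π' x t) i := by
  simp only [missingMass_run]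
  by_cases h : ∃ i, pulls (run π' x t) i < pulls (run π x t) i
  · obtain ⟨i, hi⟩ := h
    exact ⟨i, hπ.le_massAfter_of_lt_pulls x t i _ hi⟩
  -- No count is larger under `π`, and both totals equal `t`, so all counts coincide.
  · push Not at h
    have hsum : ∑ i, pulls (run π x t) i = ∑ i, pulls (run π' x t) i := by
      rw [sum_pulls, sum_pulls, length_run, length_run]
    have heq := (Finset.sum_eq_sum_iff_of_le fun i _ => h i).1 hsum
    exact ⟨π (run π x t), by rw [heq _ (Finset.mem_univ _)]⟩

end Oracle

section GoodUCB

variable {A : Set E} {P : Fin K → Measure E} {C : ℝ} {π : Policy K E}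

omit [MeasurableSpace E] in
lemma IsGoodUCB.pulls_pos (hπ : IsGoodUCB A C π) (x : Fin K → ℕ → E) {t : ℕ} (ht : K ≤ t)
    (i : Fin K) : 0 < pulls (run π x t) i := by
  have h1 : π (run π x i) = i := by
    have := (hπ (run π x i)).1 (by rw [length_run]; exact i.2)
    rw [this]
    ext
    simp [length_run]
  have h2 : 0 < pulls (run π x (i + 1)) i := by
    rw [pulls_run_succ, if_pos h1]
    exact Nat.succ_pos _
  exact h2.trans_le (pulls_run_mono π x i (i.2.trans_le ht))

/-- Since answers lie in the supports, no other expert can have produced an interesting item of `i`;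
the condition on the overall count is automatic. -/
lemma hapaxes_run (hA : NonIntersecting A P) {x : Fin K → ℕ → E}
    (hx : ∀ i n, x i n ∈ supp (P i)) (π : Policy K E) (t : ℕ) (i : Fin K) :
    hapaxes A (run π x t) i = singletons A fun k : Fin (pulls (run π x t) i) => x i k := by
  classical
  have hone : ∀ y, occ (run π x t) i y = 1 ↔ ∃! k : Fin (pulls (run π x t) i), x i k = y := by
    intro y
    rw [occ_run, Finset.card_eq_one]
    constructor
    · rintro ⟨m, hm⟩
      have hm' := Finset.mem_filter.1 (hm.symm ▸ Finset.mem_singleton_self m)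
      refine ⟨⟨m, Finset.mem_range.1 hm'.1⟩, hm'.2, fun k hk => ?_⟩
      have : (k : ℕ) ∈ ({m} : Finset ℕ) := by
        rw [← hm, Finset.mem_filter, Finset.mem_range]
        exact ⟨k.2, hk⟩
      exact Fin.ext (Finset.mem_singleton.1 this)
    · rintro ⟨k, hk, huniq⟩
      refine ⟨k, ?_⟩
      ext m
      rw [Finset.mem_filter, Finset.mem_range, Finset.mem_singleton]
      constructor
      · rintro ⟨hm, hmy⟩
        exact congrArg Fin.val (huniq ⟨m, hm⟩ hmy)
      · rintro rfl
        exact ⟨k.2, hk⟩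
  have hset : {y | y ∈ A ∧ occ (run π x t) i y = 1 ∧ ∑ j, occ (run π x t) j y = 1} =
      {y | y ∈ A ∧ ∃! k : Fin (pulls (run π x t) i), x i k = y} := by
    ext y
    change (y ∈ A ∧ _ ∧ _) ↔ (y ∈ A ∧ _)
    rw [← hone]
    refine ⟨fun h => ⟨h.1, h.2.1⟩, fun h => ⟨h.1, h.2, ?_⟩⟩
    have hyi : y ∈ supp (P i) := by
      obtain ⟨k, rfl, _⟩ := (hone y).1 h.2
      exact hx _ _
    rw [Finset.sum_eq_single i ?_ (by simp), h.2]
    intro j _ hji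
    rw [occ_run, Finset.card_eq_zero, Finset.filter_eq_empty_iff]
    rintro m _ rfl
    have : x j m ∈ A ∩ supp (P i) ∩ supp (P j) := ⟨⟨h.1, hyi⟩, hx _ _⟩
    rw [hA i j hji.symm] at this
    exact this
  rw [hapaxes, hset, singletons]

/-- The confidence bounds of the Good-Turing estimators hold for all experts and all sample sizes
up to `s`. -/
def Confident (A : Set E) (P : Fin K → Measure E) (x : Fin K → ℕ → E) (s : ℕ) : Prop :=
  ∀ i, ∀ n ∈ Finset.Icc 1 s,
    massAfter A P x i n ≤ (singletons A fun k : Fin n => x i k : ℝ) / n +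
      4 * √(Real.log (4 * (s + 1)) / n) ∧
    (singletons A fun k : Fin n => x i k : ℝ) / n ≤ massAfter A P x i n + 1 / n +
      4 * √(Real.log (4 * (s + 1)) / n)

/-- Optimism: as `C ≥ 4`, the index of `j` dominates its missing mass, while the maximal index
exceeds the missing mass of the requested expert by at most the bias plus two bonuses. -/
lemma IsGoodUCB.missingMass_le (hπ : IsGoodUCB A C π) (hC : 4 ≤ C) (hA : NonIntersecting A P)
    {x : Fin K → ℕ → E} (hx : ∀ i n, x i n ∈ supp (P i)) {s : ℕ} (hs : K ≤ s)
    (hconf : Confident A P x s) (j : Fin K) :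
    missingMass A P (run π x s) j ≤ missingMass A P (run π x s) (π (run π x s)) +
      (1 / (pulls (run π x s) (π (run π x s)) : ℝ) +
        2 * C * √(Real.log (4 * (s + 1)) / (pulls (run π x s) (π (run π x s)) : ℝ))) := by
  have hucb := (hπ (run π x s)).2 (by rw [length_run]; exact hs) j
  have hmem : ∀ i, pulls (run π x s) i ∈ Finset.Icc 1 s := by
    intro i
    rw [Finset.mem_Icc]
    refine ⟨hπ.pulls_pos x hs i, ?_⟩
    have := pulls_le_length (run π x s) i
    rwa [length_run] at this
  have h1 := (hconf j _ (hmem j)).1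
  have h2 := (hconf (π (run π x s)) _ (hmem (π (run π x s)))).2
  rw [ucbIndex, ucbIndex, goodTuring, goodTuring, hapaxes_run hA hx, hapaxes_run hA hx,
    length_run] at hucb
  rw [missingMass_run, missingMass_run]
  have h3 : ∀ a : ℝ, 4 * √a ≤ C * √a := fun a => by gcongr
  have h4 := h3 (Real.log (4 * (s + 1)) / (pulls (run π x s) j : ℝ))
  have h5 := h3 (Real.log (4 * (s + 1)) / (pulls (run π x s) (π (run π x s)) : ℝ))
  linarith

end GoodUCB

end Runs

/-! ### Sums of confidence widths and the numerical constants. -/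

section Sums

open Real

/-- The term `m = 0` is 0, because division by zero gives 0; the same convention serves the harmonic
sum. First requests are charged separately. -/
lemma sum_range_inv_sqrt_le {n : ℕ} (hn : 0 < n) :
    ∑ m ∈ Finset.range n, 1 / √(m : ℝ) ≤ 2 * √n - 1 := by
  obtain ⟨n, rfl⟩ := Nat.exists_eq_succ_of_ne_zero hn.ne'
  rcases Nat.eq_zero_or_pos n with rfl | hn
  · norm_num
  have key : ∑ m ∈ Finset.range (n + 1), 1 / √(m : ℝ) ≤ 2 * √n - 1 := by
    clear * - hn
    induction n, hn using Nat.le_induction with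
    | base => norm_num [Finset.sum_range_succ]
    | succ n hn ih =>
      rw [Finset.sum_range_succ]
      have h1 : 0 < √((n + 1 : ℕ) : ℝ) := sqrt_pos.2 (by positivity)
      have h2 : √((n + 1 : ℕ) : ℝ) ^ 2 = n + 1 := by
        rw [sq_sqrt (by positivity)]
        push_cast
        rfl
      have h3 : √(n : ℝ) ^ 2 = n := sq_sqrt (by positivity)
      have h4 : 1 / √((n + 1 : ℕ) : ℝ) ≤ 2 * √((n + 1 : ℕ) : ℝ) - 2 * √(n : ℝ) := by
        rw [div_le_iff₀ h1]
        nlinarith [sq_nonneg (√((n + 1 : ℕ) : ℝ) - √(n : ℝ))]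
      linarith
  have : √(n : ℝ) ≤ √((n + 1 : ℕ) : ℝ) := by
    gcongr
    exact Nat.le_succ n
  rw [Nat.succ_eq_add_one]
  linarith

lemma sum_range_inv_le {n : ℕ} (hn : 0 < n) :
    ∑ m ∈ Finset.range n, 1 / (m : ℝ) ≤ 1 + log n := by
  have h := harmonic_le_one_add_log n
  refine le_trans ?_ h
  rw [harmonic]
  push_cast
  obtain ⟨m, rfl⟩ := Nat.exists_eq_succ_of_ne_zero hn.ne'
  rw [Finset.sum_range_succ']
  simp only [Nat.cast_zero, div_zero, add_zero, one_div]
  push_cast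
  refine Finset.sum_le_sum_of_subset_of_nonneg (Finset.range_mono (Nat.le_succ m)) ?_
  intro i _ _
  positivity

lemma sum_sqrt_le_sqrt_card_mul_sum {ι : Type*} (I : Finset ι) (n : ι → ℕ) :
    ∑ i ∈ I, √(n i : ℝ) ≤ √((I.card : ℝ) * ∑ i ∈ I, (n i : ℝ)) := by
  refine le_sqrt_of_sq_le ?_
  have h := sq_sum_le_card_mul_sum_sq (s := I) (f := fun i => √(n i : ℝ))
  simpa only [sq_sqrt (Nat.cast_nonneg _)] using h

/-- Jensen's inequality, from the tangent to log at the mean `T / I.card`. -/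
lemma sum_log_le_card_mul_log {ι : Type*} {I : Finset ι} {n : ι → ℕ} (hn : ∀ i ∈ I, 0 < n i)
    (hI : I.Nonempty) :
    ∑ i ∈ I, log (n i : ℝ) ≤ I.card * log ((∑ i ∈ I, (n i : ℝ)) / I.card) := by
  set T := ∑ i ∈ I, (n i : ℝ) with hT
  have hT0 : 0 < T := Finset.sum_pos (fun i hi => by exact_mod_cast hn i hi) hI
  have hc : (0 : ℝ) < I.card := by exact_mod_cast hI.card_pos
  have h : ∀ i ∈ I, log (n i : ℝ) ≤ log (T / I.card) + (n i * (I.card / T) - 1) := by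
    intro i hi
    have hi0 : (0 : ℝ) < n i := by exact_mod_cast hn i hi
    have h1 := log_le_sub_one_of_pos (show 0 < n i * (I.card / T) by positivity)
    rw [log_mul hi0.ne' (by positivity), log_div hc.ne' hT0.ne'] at h1
    rw [log_div hT0.ne' hc.ne']
    linarith
  refine (Finset.sum_le_sum h).trans_eq ?_
  rw [Finset.sum_add_distrib, Finset.sum_sub_distrib, ← Finset.sum_mul, ← hT]
  simp only [Finset.sum_const, nsmul_eq_mul, mul_one]
  field_simp
  ring

lemma log_le_sqrt {x : ℝ} (hx : 0 < x) : log x ≤ √x := by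
  have h1 := log_le_sub_one_of_pos (show 0 < √x / 2 by positivity)
  rw [log_div (by positivity) (by norm_num), log_sqrt hx.le] at h1
  have h2 := log_two_lt_d9
  linarith

lemma mul_log_div_le_sqrt_mul {k t : ℝ} (hk : 0 < k) (ht : 0 < t) :
    k * log (t / k) ≤ √(k * t) := by
  calc k * log (t / k) ≤ k * √(t / k) := by
        gcongr
        exact log_le_sqrt (by positivity)
    _ = √(k ^ 2 * (t / k)) := by rw [sqrt_mul (by positivity), sqrt_sq hk.le]
    _ = _ := by congr 1; field_simp

lemma four_le_ucbParam : 4 ≤ (1 + √2) * √3 := by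
  have h1 : (1.41 : ℝ) ≤ √2 := le_sqrt_of_sq_le (by norm_num)
  have h2 : (1.73 : ℝ) ≤ √3 := le_sqrt_of_sq_le (by norm_num)
  nlinarith

lemma ucbParam_le : (1 + √2) * √3 ≤ 4.1816 := by
  have h1 : √2 ≤ 1.41422 := sqrt_le_iff.2 (by norm_num)
  have h2 : √3 ≤ 1.73206 := sqrt_le_iff.2 (by norm_num)
  have h3 : 0 ≤ √2 := sqrt_nonneg _
  have h4 : 0 ≤ √3 := sqrt_nonneg _
  nlinarith

/-- Here `4C < 17`, and `4C√(log 4)` is about 19.7; adding the 1/8 from `k log(t/k) ≤ √(kt)` stays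
below 20. The surplus `k` is absorbed by `-2C√(log(4t)) k ≤ -8k`. -/
lemma regret_arith {k t : ℝ} (hk : 1 ≤ k) (hkt : k ≤ t) :
    k + k / 8 * log (t / k) + (k + k * log (t / k) +
      2 * ((1 + √2) * √3) * √(log (4 * t)) * (2 * √(k * t) - k)) ≤
    17 * √(k * t * log t) + 20 * √(k * t) + k + k * log (t / k) := by
  set C := (1 + √2) * √3 with hC
  have hC1 : 4 ≤ C := four_le_ucbParam
  have hC2 : C ≤ 4.1816 := ucbParam_le
  have ht : 1 ≤ t := hk.trans hkt
  have hlogt : 0 ≤ log t := log_nonneg ht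
  have hlog4 : log 4 = 2 * log 2 := by
    rw [show (4 : ℝ) = 2 ^ 2 by norm_num, log_pow]
    norm_num
  have hlog2 := log_two_lt_d9
  have hlog2' := log_two_gt_d9
  -- 1.1775 is just above `√(log 4)`.
  have hw : √(log (4 * t)) ≤ √(log t) + 1.1775 := by
    refine sqrt_le_iff.2 ⟨by positivity, ?_⟩
    rw [log_mul (by norm_num) (by positivity)]
    nlinarith [sq_sqrt hlogt, sqrt_nonneg (log t)]
  have hw1 : 1 ≤ √(log (4 * t)) := by
    refine le_sqrt_of_sq_le ?_
    rw [log_mul (by norm_num) (by positivity)]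
    linarith
  have hS : k ≤ √(k * t) := le_sqrt_of_sq_le (by nlinarith)
  have hSa : √(k * t * log t) = √(k * t) * √(log t) := sqrt_mul (by positivity) _
  have hlog := mul_log_div_le_sqrt_mul (show 0 < k by linarith) (show 0 < t by linarith)
  rw [hSa]
  set S := √(k * t)
  set a := √(log t)
  set w := √(log (4 * t))
  have ha : 0 ≤ a := sqrt_nonneg _
  have hS0 : 0 ≤ S := sqrt_nonneg _
  have h1 : C * w * S ≤ 4.1816 * (a + 1.1775) * S := by gcongr
  have h2 : 4 * 1 * k ≤ C * w * k := by gcongr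
  have h3 : 0 ≤ S * a := mul_nonneg hS0 ha
  nlinarith

end Sums

end Discovery

namespace Discovery

/-! ### Comparison of the two policies on a fixed array of answers. -/

section PathwiseRegret

variable {K : ℕ} {E : Type*} [MeasurableSpace E]
variable {A : Set E} {P : Fin K → Measure E}

lemma missingMass_nonneg (h : History K E) (i : Fin K) : 0 ≤ missingMass A P h i :=
  measureReal_nonneg

variable [∀ i, IsProbabilityMeasure (P i)]

lemma missingMass_le_one (h : History K E) (i : Fin K) : missingMass A P h i ≤ 1 :=
  measureReal_le_one

open Classical in
-- The first `K` steps and the steps where confidence fails cost at most 1 each; any other step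
-- costs the width of the requested expert.
lemma sum_missingMass_sub_le (hK : 1 ≤ K) (hA : NonIntersecting A P) {C : ℝ} (hC : 4 ≤ C)
    {ucb ocl : Policy K E} (hucb : IsGoodUCB A C ucb) (hocl : IsOCL A P ocl)
    {x : Fin K → ℕ → E} (hx : ∀ i n, x i n ∈ supp (P i)) {t : ℕ} (ht : K ≤ t) :
    ∑ s ∈ Finset.range t, (missingMass A P (run ocl x s) (ocl (run ocl x s)) -
      missingMass A P (run ucb x s) (ucb (run ucb x s))) ≤
    K + ∑ s ∈ Finset.Ico K t, (if Confident A P x s then 0 else 1 : ℝ) +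
      (K + K * Real.log (t / K) + 2 * C * √(Real.log (4 * t)) * (2 * √(K * t) - K)) := by
  set w := √(Real.log (4 * t)) with hw
  set N : ℕ → ℕ := fun s => pulls (run ucb x s) (ucb (run ucb x s)) with hN
  have hC0 : 0 ≤ C := by linarith
  have hstep : ∀ s ∈ Finset.range t, missingMass A P (run ocl x s) (ocl (run ocl x s)) -
      missingMass A P (run ucb x s) (ucb (run ucb x s)) ≤
      (if s < K then 1 else if Confident A P x s then 0 else 1 : ℝ) +
        (1 / (N s : ℝ) + 2 * C * w * (1 / √(N s : ℝ))) := by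
    intro s hs
    have hpos : 0 ≤ 1 / (N s : ℝ) + 2 * C * w * (1 / √(N s : ℝ)) := by positivity
    have hone : missingMass A P (run ocl x s) (ocl (run ocl x s)) -
        missingMass A P (run ucb x s) (ucb (run ucb x s)) ≤ 1 := by
      have h1 := missingMass_le_one (A := A) (P := P) (run ocl x s) (ocl (run ocl x s))
      have h2 := missingMass_nonneg (A := A) (P := P) (run ucb x s) (ucb (run ucb x s))
      linarith
    split_ifs with h1 h2
    · linarith
    · obtain ⟨j, hj⟩ := hocl.exists_missingMass_le ucb x s
      have h3 := hucb.missingMass_le hC hA hx (not_lt.1 h1) h2 j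
      have hst : ((s : ℝ) + 1) ≤ t := by exact_mod_cast Finset.mem_range.1 hs
      have h4 : √(Real.log (4 * (s + 1)) / (N s : ℝ)) ≤ w * (1 / √(N s : ℝ)) := by
        rw [Real.sqrt_div' _ (Nat.cast_nonneg _), div_eq_mul_one_div]
        refine mul_le_mul_of_nonneg_right (Real.sqrt_le_sqrt ?_) (by positivity)
        exact Real.log_le_log (by positivity) (by linarith)
      have h5 : 2 * C * √(Real.log (4 * (s + 1)) / (N s : ℝ)) ≤
          2 * C * (w * (1 / √(N s : ℝ))) := by gcongr
      linarith
    · linarith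
  have hK0 : (0 : ℝ) < K := by exact_mod_cast hK
  have hne : (Finset.univ : Finset (Fin K)).Nonempty := ⟨⟨0, hK⟩, Finset.mem_univ _⟩
  have hn : ∀ i, 0 < pulls (run ucb x t) i := fun i => hucb.pulls_pos x ht i
  have hsum : ∑ i, (pulls (run ucb x t) i : ℝ) = t := by
    rw [← Nat.cast_sum, sum_pulls, length_run]
  have hinv : ∑ s ∈ Finset.range t, 1 / (N s : ℝ) ≤ K + K * Real.log (t / K) := by
    rw [sum_run_eq ucb x (fun n => 1 / (n : ℝ)) t]
    refine (Finset.sum_le_sum fun i _ => sum_range_inv_le (hn i)).trans ?_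
    rw [Finset.sum_add_distrib]
    have := sum_log_le_card_mul_log (I := Finset.univ) (n := fun i => pulls (run ucb x t) i)
      (fun i _ => hn i) hne
    rw [hsum] at this
    simpa using this
  have hsqrt : ∑ s ∈ Finset.range t, 1 / √(N s : ℝ) ≤ 2 * √(K * t) - K := by
    rw [sum_run_eq ucb x (fun n => 1 / √(n : ℝ)) t]
    refine (Finset.sum_le_sum fun i _ => sum_range_inv_sqrt_le (hn i)).trans ?_
    rw [Finset.sum_sub_distrib, ← Finset.mul_sum]
    have := sum_sqrt_le_sqrt_card_mul_sum Finset.univ fun i => pulls (run ucb x t) i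
    rw [hsum] at this
    simp only [Finset.card_univ, Fintype.card_fin, Finset.sum_const, nsmul_eq_mul, mul_one]
      at this ⊢
    linarith
  have hbad : ∑ s ∈ Finset.range t, (if s < K then 1 else if Confident A P x s then 0 else 1 : ℝ) =
      K + ∑ s ∈ Finset.Ico K t, (if Confident A P x s then 0 else 1 : ℝ) := by
    rw [Finset.range_eq_Ico, ← Finset.sum_Ico_consecutive _ (Nat.zero_le K) ht]
    congr 1
    · rw [Finset.sum_congr rfl fun s hs => if_pos (Finset.mem_Ico.1 hs).2]
      simp
    · exact Finset.sum_congr rfl fun s hs => if_neg (not_lt.2 (Finset.mem_Ico.1 hs).1)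
  refine (Finset.sum_le_sum hstep).trans ?_
  rw [Finset.sum_add_distrib, Finset.sum_add_distrib, ← Finset.mul_sum, hbad]
  have h6 : 2 * C * w * ∑ s ∈ Finset.range t, 1 / √(N s : ℝ) ≤
      2 * C * w * (2 * √(K * t) - K) := by gcongr
  linarith

end PathwiseRegret

/-! ### Probability that the confidence bounds fail. -/

section ConfidenceProbability

variable {Ω E : Type*} [MeasurableSpace Ω] [Countable E] [MeasurableSpace E]
  [MeasurableSingletonClass E] {μ : Measure Ω} [IsProbabilityMeasure μ] {K : ℕ}
  {P : Fin K → Measure E} [∀ i, IsProbabilityMeasure (P i)] {X : Fin K → ℕ → Ω → E}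

omit [IsProbabilityMeasure μ] [Countable E] [MeasurableSingletonClass E]
  [∀ i, IsProbabilityMeasure (P i)] in
lemma map_answers_eq_draws (hX : ∀ i n, Measurable (X i n)) (hlaw : ∀ i n, μ.map (X i n) = P i)
    (hindep : iIndepFun (fun (p : Fin K × ℕ) => X p.1 p.2) μ) (i : Fin K) (n : ℕ) :
    μ.map (fun ω (k : Fin n) => X i k ω) = draws (P i) n := by
  have hinj : Function.Injective fun k : Fin n => ((i, (k : ℕ)) : Fin K × ℕ) := by
    intro k l h
    exact Fin.ext (Prod.mk.inj h).2
  have h := hindep.precomp hinj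
  have := h.isProbabilityMeasure
  rw [iIndepFun_iff_map_fun_eq_pi_map fun k : Fin n => (hX i k).aemeasurable] at h
  simp only [hlaw] at h
  exact h

omit [Countable E] [MeasurableSingletonClass E] in
lemma measurable_pi_answers (hX : ∀ i n, Measurable (X i n)) (i : Fin K) (n : ℕ) :
    Measurable fun ω (k : Fin n) => X i k ω :=
  measurable_pi_lambda _ fun k => hX i k

omit [∀ i, IsProbabilityMeasure (P i)] in
lemma measurableSet_confident (hX : ∀ i n, Measurable (X i n)) (A : Set E) (s : ℕ) :
    MeasurableSet {ω | Confident A P (fun i n => X i n ω) s} := by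
  have h : {ω | Confident A P (fun i n => X i n ω) s} = ⋂ i, ⋂ n ∈ Finset.Icc 1 s,
      (fun ω (k : Fin n) => X i k ω) ⁻¹' {x | (P i).real (A \ Set.range x) ≤
        (singletons A x : ℝ) / n + 4 * √(Real.log (4 * (s + 1)) / n) ∧
        (singletons A x : ℝ) / n ≤ (P i).real (A \ Set.range x) + 1 / n +
        4 * √(Real.log (4 * (s + 1)) / n)} := by
    ext ω
    simp only [Set.mem_iInter]
    rfl
  rw [h]
  refine MeasurableSet.iInter fun i => Finset.measurableSet_biInter _ fun n _ => ?_
  exact measurable_pi_answers hX i n (Set.to_countable _).measurableSet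

/-- The sample sizes reached are random, hence a union over all `n ≤ s`, the `K` experts and two
tails: `2Ks exp(-2L)` with `exp(-2L) = 1/(16(s+1)²)`. -/
lemma measureReal_not_confident_le (hX : ∀ i n, Measurable (X i n))
    (hlaw : ∀ i n, μ.map (X i n) = P i)
    (hindep : iIndepFun (fun (p : Fin K × ℕ) => X p.1 p.2) μ) (A : Set E) (s : ℕ) :
    μ.real {ω | ¬Confident A P (fun i n => X i n ω) s} ≤ K / 8 * (1 / (s + 1)) := by
  set L := Real.log (4 * (s + 1)) with hL
  have hL0 : 0 ≤ L := Real.log_nonneg (by linarith [(Nat.cast_nonneg s : (0 : ℝ) ≤ s)])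
  have hexp : Real.exp (-2 * L) = 1 / (16 * (s + 1) ^ 2) := by
    rw [show -2 * L = -(2 * L) by ring, Real.exp_neg, hL, show (2 : ℝ) = (2 : ℕ) by norm_num,
      Real.exp_nat_mul, Real.exp_log (by positivity)]
    rw [one_div]
    congr 1
    ring
  have hpre : ∀ (i : Fin K) (n : ℕ) (T : Set (Fin n → E)),
      μ.real ((fun ω (k : Fin n) => X i k ω) ⁻¹' T) = (draws (P i) n).real T := by
    intro i n T
    rw [← map_answers_eq_draws hX hlaw hindep i n,
      map_measureReal_apply (measurable_pi_answers hX i n) (Set.to_countable _).measurableSet]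
  have hsub : {ω | ¬Confident A P (fun i n => X i n ω) s} ⊆ ⋃ i ∈ (Finset.univ : Finset (Fin K)),
      ⋃ n ∈ Finset.Icc 1 s, (fun ω (k : Fin n) => X i k ω) ⁻¹'
        ({x | (singletons A x : ℝ) / n + 4 * √(L / n) ≤ (P i).real (A \ Set.range x)} ∪
          {x | (P i).real (A \ Set.range x) + 1 / n + 4 * √(L / n) ≤
            (singletons A x : ℝ) / n}) := by
    intro ω hω
    change ¬Confident _ _ _ _ at hω
    unfold Confident at hω
    push Not at hω
    obtain ⟨i, n, hn, h⟩ := hω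
    simp only [Set.mem_iUnion]
    refine ⟨i, Finset.mem_univ _, n, hn, ?_⟩
    by_cases h1 : massAfter A P (fun i n => X i n ω) i n ≤
        (singletons A fun k : Fin n => X i k ω : ℝ) / n + 4 * √(L / n)
    · exact Or.inr (h h1).le
    · exact Or.inl (not_le.1 h1).le
  calc _ ≤ _ := measureReal_mono hsub (measure_ne_top _ _)
    _ ≤ ∑ i : Fin K, _ := measureReal_biUnion_finset_le _ _
    _ ≤ ∑ _i : Fin K, ∑ n ∈ Finset.Icc 1 s, (Real.exp (-2 * L) + Real.exp (-2 * L)) := by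
        refine Finset.sum_le_sum fun i _ => (measureReal_biUnion_finset_le _ _).trans ?_
        refine Finset.sum_le_sum fun n hn => ?_
        have hn0 : n ≠ 0 := Nat.one_le_iff_ne_zero.1 (Finset.mem_Icc.1 hn).1
        rw [hpre]
        refine (measureReal_union_le _ _).trans (add_le_add ?_ ?_)
        · exact measureReal_goodTuring_add_le_missingMass _ hn0 A hL0
        · exact measureReal_missingMass_add_le_goodTuring _ hn0 A hL0
    _ = K / 8 * (s / (s + 1) ^ 2) := by
        rw [hexp]
        simp only [Finset.sum_const, Finset.card_univ, Fintype.card_fin, Nat.card_Icc,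
          add_tsub_cancel_right, nsmul_eq_mul]
        field_simp
        ring
    _ ≤ _ := by
        refine mul_le_mul_of_nonneg_left ?_ (by positivity)
        rw [div_le_div_iff₀ (by positivity) (by positivity)]
        nlinarith [(Nat.cast_nonneg s : (0 : ℝ) ≤ s)]

/-- Telescoping of `1/(s+1) ≤ log((s+1)/s)`. -/
lemma sum_Ico_inv_succ_le {k t : ℕ} (hk : 0 < k) (hkt : k ≤ t) :
    ∑ s ∈ Finset.Ico k t, 1 / ((s : ℝ) + 1) ≤ Real.log (t / k) := by
  have hk0 : (0 : ℝ) < k := by exact_mod_cast hk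
  induction t, hkt using Nat.le_induction with
  | base => simp [hk0.ne']
  | succ n hn ih =>
    have hn0 : (0 : ℝ) < n := by exact_mod_cast hk.trans_le hn
    rw [Finset.sum_Ico_succ_top hn]
    have h := Real.log_le_sub_one_of_pos (show 0 < (n : ℝ) / (n + 1) by positivity)
    rw [Real.log_div hn0.ne' (by positivity)] at h
    rw [Real.log_div (by positivity) hk0.ne'] at ih ⊢
    push_cast
    have h2 : (n : ℝ) / (n + 1) - 1 = -(1 / (n + 1)) := by field_simp; ring
    linarith

end ConfidenceProbability

end Discovery

namespace Discovery

/-! ### Histories as events. -/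

section Histories

variable {K : ℕ} {E : Type*}

/-- The items that occur in a history. -/
def seen (h : History K E) : Set E := {y | ∃ i, (i, y) ∈ h}

lemma finite_seen (h : History K E) : (seen h).Finite := by
  refine (h.finite_toSet.image Prod.snd).subset ?_
  rintro y ⟨i, hi⟩
  exact ⟨(i, y), hi, rfl⟩

lemma found_cons (A : Set E) (h : History K E) (i : Fin K) (y : E) :
    (found A ((i, y) :: h) : ℝ) = found A h + (A \ seen h).indicator 1 y := by
  classical
  have hfin : {z | z ∈ A ∧ ∃ j, (j, z) ∈ h}.Finite := (finite_seen h).subset fun z hz => hz.2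
  have hiff : ∀ z, (∃ j, (j, z) ∈ (i, y) :: h) ↔ z = y ∨ ∃ j, (j, z) ∈ h := by
    intro z
    simp only [List.mem_cons, Prod.mk.injEq]
    constructor
    · rintro ⟨j, ⟨_, rfl⟩ | hj⟩
      · exact Or.inl rfl
      · exact Or.inr ⟨j, hj⟩
    · rintro (rfl | ⟨j, hj⟩)
      · exact ⟨i, Or.inl ⟨rfl, rfl⟩⟩
      · exact ⟨j, Or.inr hj⟩
  unfold found
  simp only [hiff]
  by_cases hy : y ∈ A \ seen h
  · have hset : {z | z ∈ A ∧ (z = y ∨ ∃ j, (j, z) ∈ h)} =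
        insert y {z | z ∈ A ∧ ∃ j, (j, z) ∈ h} := by
      ext z
      change (z ∈ A ∧ (z = y ∨ ∃ j, (j, z) ∈ h)) ↔ (z = y ∨ (z ∈ A ∧ ∃ j, (j, z) ∈ h))
      constructor
      · rintro ⟨hz, rfl | hz'⟩
        · exact Or.inl rfl
        · exact Or.inr ⟨hz, hz'⟩
      · rintro (rfl | ⟨hz, hz'⟩)
        · exact ⟨hy.1, Or.inl rfl⟩
        · exact ⟨hz, Or.inr hz'⟩
    rw [hset, Set.ncard_insert_of_notMem (fun h' => hy.2 h'.2) hfin, Set.indicator_of_mem hy]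
    simp
  · have hset : {z | z ∈ A ∧ (z = y ∨ ∃ j, (j, z) ∈ h)} = {z | z ∈ A ∧ ∃ j, (j, z) ∈ h} := by
      ext z
      change (z ∈ A ∧ (z = y ∨ ∃ j, (j, z) ∈ h)) ↔ (z ∈ A ∧ ∃ j, (j, z) ∈ h)
      refine ⟨?_, fun hz => ⟨hz.1, Or.inr hz.2⟩⟩
      rintro ⟨hz, rfl | hz'⟩
      · refine ⟨hz, ?_⟩
        by_contra hn
        exact hy ⟨hz, hn⟩
      · exact ⟨hz, hz'⟩
    rw [hset, Set.indicator_of_notMem hy, add_zero]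

lemma found_le_length (A : Set E) (h : History K E) : found A h ≤ h.length := by
  classical
  have hsub : {y | y ∈ A ∧ ∃ i, (i, y) ∈ h} ⊆ ↑(h.map Prod.snd).toFinset := by
    rintro y ⟨_, i, hi⟩
    simp only [List.coe_toFinset, List.mem_map]
    exact ⟨(i, y), hi, rfl⟩
  calc found A h ≤ _ := Set.ncard_le_ncard hsub (Finset.finite_toSet _)
    _ = (h.map Prod.snd).toFinset.card := Set.ncard_coe_finset _
    _ ≤ (h.map Prod.snd).length := List.toFinset_card_le _
    _ = h.length := List.length_map _

/-- The answers recorded in `h` are those of `x`. -/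
def AnswersOf (x : Fin K → ℕ → E) : History K E → Prop
  | [] => True
  | p :: h => x p.1 (pulls h p.1) = p.2 ∧ AnswersOf x h

/-- The requests recorded in `h` are those of `π`. -/
def RequestsOf (π : Policy K E) : History K E → Prop
  | [] => True
  | p :: h => π h = p.1 ∧ RequestsOf π h

/-- Splits the event of a given history into a condition on the policy alone and one on the answers
alone, so that independence of tie-breaking and answers can be used. -/
lemma run_eq_iff (π : Policy K E) (x : Fin K → ℕ → E) (h : History K E) :
    run π x h.length = h ↔ RequestsOf π h ∧ AnswersOf x h := by
  induction h with
  | nil => simp [run, RequestsOf, AnswersOf]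
  | cons p h ih =>
    obtain ⟨i, y⟩ := p
    rw [List.length_cons, run, List.cons.injEq, Prod.mk.injEq, RequestsOf, AnswersOf]
    constructor
    · rintro ⟨⟨h1, h2⟩, h3⟩
      rw [h3] at h1 h2
      subst h1
      exact ⟨⟨rfl, (ih.1 h3).1⟩, h2, (ih.1 h3).2⟩
    · rintro ⟨⟨h1, h2⟩, h3, h4⟩
      have h5 := ih.2 ⟨h2, h4⟩
      rw [h5, h1]
      exact ⟨⟨rfl, h3⟩, rfl⟩

/-- A history involves only the first `pulls h i` answers of each expert, which leaves the next
answer fresh. -/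
lemma answersOf_congr {x x' : Fin K → ℕ → E} {h : History K E}
    (hx : ∀ i, ∀ m < pulls h i, x i m = x' i m) : AnswersOf x h ↔ AnswersOf x' h := by
  induction h with
  | nil => rfl
  | cons p h ih =>
    obtain ⟨j, y⟩ := p
    rw [AnswersOf, AnswersOf]
    have h1 : x j (pulls h j) = x' j (pulls h j) :=
      hx j _ (by rw [pulls_cons, if_pos rfl]; exact Nat.lt_succ_self _)
    have h2 := ih fun i m hm => hx i m (by rw [pulls_cons]; exact Nat.lt_add_right _ hm)
    simp only [h1, h2]

end Histories

/-! ### Measurability and total probability over a countable partition. -/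

section Fibres

variable {Ω ι : Type*} [MeasurableSpace Ω] [Countable ι] {J : Ω → ι}

lemma measurableSet_of_fibres (hJ : ∀ j, MeasurableSet (J ⁻¹' {j})) {D : ι → Set Ω}
    (hD : ∀ j, MeasurableSet (D j)) : MeasurableSet {ω | ω ∈ D (J ω)} := by
  have : {ω | ω ∈ D (J ω)} = ⋃ j, J ⁻¹' {j} ∩ D j := by
    ext ω
    simp
  rw [this]
  exact MeasurableSet.iUnion fun j => (hJ j).inter (hD j)

lemma measurable_comp_of_fibres (hJ : ∀ j, MeasurableSet (J ⁻¹' {j})) {β : Type*}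
    [MeasurableSpace β] (c : ι → β) : Measurable fun ω => c (J ω) := by
  intro B _
  exact measurableSet_of_fibres hJ (D := fun j => {_ω | c j ∈ B}) fun j => MeasurableSet.const _

/-- Law of total probability: `c j` plays the role of the conditional probability of `D j` given `J
= j`. -/
lemma measureReal_eq_integral_of_fibres {μ : Measure Ω} [IsProbabilityMeasure μ]
    (hJ : ∀ j, MeasurableSet (J ⁻¹' {j})) {D : ι → Set Ω} (hD : ∀ j, MeasurableSet (D j))
    {c : ι → ℝ} (hc : ∀ j, |c j| ≤ 1)
    (h : ∀ j, μ.real (J ⁻¹' {j} ∩ D j) = μ.real (J ⁻¹' {j}) * c j) :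
    μ.real {ω | ω ∈ D (J ω)} = ∫ ω, c (J ω) ∂μ := by
  have hDm := measurableSet_of_fibres hJ hD
  have hcover : ⋃ j, J ⁻¹' {j} = Set.univ := by
    ext ω
    simp
  have hdisj : Pairwise (Function.onFun Disjoint fun j => J ⁻¹' {j}) := by
    intro j k hjk
    exact Disjoint.preimage J (Set.disjoint_singleton.2 hjk)
  have hint : Integrable ({ω | ω ∈ D (J ω)}.indicator (1 : Ω → ℝ)) μ :=
    (integrable_const (1 : ℝ)).indicator hDm
  rw [← integral_indicator_one hDm, ← setIntegral_univ (f := Set.indicator _ _),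
    ← setIntegral_univ (f := fun ω => c (J ω)), ← hcover,
    integral_iUnion hJ hdisj hint.integrableOn,
    integral_iUnion hJ hdisj]
  · congr 1
    ext j
    have h1 : ∫ ω in J ⁻¹' {j}, c (J ω) ∂μ = ∫ _ in J ⁻¹' {j}, c j ∂μ :=
      setIntegral_congr_fun (hJ j) fun ω hω => congrArg c hω
    have h2 : ∫ ω in J ⁻¹' {j}, {ω | ω ∈ D (J ω)}.indicator 1 ω ∂μ =
        ∫ ω in J ⁻¹' {j}, (D j).indicator (1 : Ω → ℝ) ω ∂μ :=
      setIntegral_congr_fun (hJ j) fun ω hω => by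
        have hmem : ω ∈ {ω | ω ∈ D (J ω)} ↔ ω ∈ D j := by
          change ω ∈ D (J ω) ↔ _
          rw [show J ω = j from hω]
        by_cases hωD : ω ∈ D j
        · rw [Set.indicator_of_mem hωD, Set.indicator_of_mem (hmem.2 hωD)]
        · rw [Set.indicator_of_notMem hωD, Set.indicator_of_notMem (mt hmem.1 hωD)]
    rw [h1, h2, setIntegral_const, smul_eq_mul, ← h j, integral_indicator_one (hD j),
      measureReal_restrict_apply (hD j), Set.inter_comm]
  · refine Integrable.integrableOn (Integrable.of_bound
      (measurable_comp_of_fibres hJ c).aestronglyMeasurable 1 ?_)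
    exact Filter.Eventually.of_forall fun ω => hc _

end Fibres

/-! ### Expected finds as expected sums of missing masses. -/

section ExpectedFound

variable {Ω E S : Type*} [MeasurableSpace Ω] [MeasurableSpace S] [Countable E] [MeasurableSpace E]
  [MeasurableSingletonClass E] {μ : Measure Ω} [IsProbabilityMeasure μ] {K : ℕ}
  {P : Fin K → Measure E} [∀ i, IsProbabilityMeasure (P i)] {X : Fin K → ℕ → Ω → E} {U : Ω → S}
  {pol : S → Policy K E}

omit [Countable E] [MeasurableSingletonClass E] [MeasurableSpace E] in
lemma measurableSet_requestsOf (hpol : ∀ h, Measurable fun s => pol s h) (h : History K E) :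
    MeasurableSet {s | RequestsOf (pol s) h} := by
  induction h with
  | nil => exact MeasurableSet.univ
  | cons p h ih => exact (hpol h (measurableSet_singleton p.1)).inter ih

omit [Countable E] in
lemma measurableSet_answersOf (hX : ∀ i n, Measurable (X i n)) (h : History K E) :
    MeasurableSet {ω | AnswersOf (fun i n => X i n ω) h} := by
  induction h with
  | nil => exact MeasurableSet.univ
  | cons p h ih => exact (hX p.1 _ (measurableSet_singleton p.2)).inter ih

omit [MeasurableSpace Ω] [MeasurableSpace S] [Countable E] [MeasurableSpace E]
  [MeasurableSingletonClass E] in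
lemma run_fibre_eq (pol : S → Policy K E) (U : Ω → S) (X : Fin K → ℕ → Ω → E) (t : ℕ)
    (h : History K E) (i : Fin K) :
    (fun ω => (run (pol (U ω)) (fun i n => X i n ω) t,
      pol (U ω) (run (pol (U ω)) (fun i n => X i n ω) t))) ⁻¹' {(h, i)} =
      {ω | h.length = t ∧ (RequestsOf (pol (U ω)) h ∧ pol (U ω) h = i) ∧
        AnswersOf (fun i n => X i n ω) h} := by
  ext ω
  change (_, _) = (h, i) ↔ _ ∧ (_ ∧ _) ∧ _
  rw [Prod.mk.injEq]
  constructor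
  · rintro ⟨h1, h2⟩
    have hl : h.length = t := by rw [← h1, length_run]
    subst hl
    have h3 := (run_eq_iff _ _ _).1 h1
    rw [h1] at h2
    exact ⟨rfl, ⟨h3.1, h2⟩, h3.2⟩
  · rintro ⟨rfl, ⟨h1, h2⟩, h3⟩
    have h4 := (run_eq_iff _ _ _).2 ⟨h1, h3⟩
    rw [h4]
    exact ⟨rfl, h2⟩

omit [Countable E] in
lemma measurableSet_run_fibre (hX : ∀ i n, Measurable (X i n)) (hU : Measurable U)
    (hpol : ∀ h, Measurable fun s => pol s h) (t : ℕ) (p : History K E × Fin K) :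
    MeasurableSet ((fun ω => (run (pol (U ω)) (fun i n => X i n ω) t,
      pol (U ω) (run (pol (U ω)) (fun i n => X i n ω) t))) ⁻¹' {p}) := by
  obtain ⟨h, i⟩ := p
  rw [run_fibre_eq]
  refine (MeasurableSet.const _).inter (MeasurableSet.inter ?_ (measurableSet_answersOf hX h))
  exact hU ((measurableSet_requestsOf hpol h).inter (hpol h (measurableSet_singleton i)))

omit [IsProbabilityMeasure μ] [∀ i, IsProbabilityMeasure (P i)] in
/-- The next answer of an expert is independent of the answers recorded in a history. -/
lemma measureReal_answersOf_inter (hX : ∀ i n, Measurable (X i n))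
    (hlaw : ∀ i n, μ.map (X i n) = P i)
    (hindep : iIndepFun (fun (p : Fin K × ℕ) => X p.1 p.2) μ) (h : History K E) (i : Fin K)
    (G : Set E) :
    μ.real ({ω | AnswersOf (fun i n => X i n ω) h} ∩ X i (pulls h i) ⁻¹' G) =
      μ.real {ω | AnswersOf (fun i n => X i n ω) h} * (P i).real G := by
  classical
  set I : Finset (Fin K × ℕ) :=
    Finset.univ.biUnion fun j => (Finset.range (pulls h j)).image fun m => (j, m) with hI
  have hmemI : ∀ j m, (j, m) ∈ I ↔ m < pulls h j := by
    intro j m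
    simp [hI]
  have hdisj : Disjoint I {(i, pulls h i)} := by
    rw [Finset.disjoint_singleton_right, hmemI]
    exact lt_irrefl _
  have hind := hindep.indepFun_finset I {(i, pulls h i)} hdisj fun p => hX p.1 p.2
  -- The values of `x` outside `I` are arbitrary; by `answersOf_congr` they do not affect
  -- membership.
  set D : Set (I → E) := {z | ∃ x : Fin K → ℕ → E, (∀ p : I, x p.1.1 p.1.2 = z p) ∧ AnswersOf x h}
  have hD : {ω | AnswersOf (fun i n => X i n ω) h} =
      (fun ω (p : I) => X p.1.1 p.1.2 ω) ⁻¹' D := by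
    ext ω
    constructor
    · intro hω
      exact ⟨fun i n => X i n ω, fun p => rfl, hω⟩
    · rintro ⟨x, hx, hxh⟩
      refine (answersOf_congr fun j m hm => ?_).1 hxh
      exact hx ⟨(j, m), (hmemI j m).2 hm⟩
  have hG : X i (pulls h i) ⁻¹' G =
      (fun ω (p : ({(i, pulls h i)} : Finset (Fin K × ℕ))) => X p.1.1 p.1.2 ω) ⁻¹'
        {z | z ⟨(i, pulls h i), Finset.mem_singleton_self _⟩ ∈ G} := rfl
  have hmul := hind.measure_inter_preimage_eq_mul D
    {z | z ⟨(i, pulls h i), Finset.mem_singleton_self _⟩ ∈ G}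
    (Set.to_countable _).measurableSet (Set.to_countable _).measurableSet
  rw [← hD, ← hG] at hmul
  rw [Measure.real, hmul, ENNReal.toReal_mul, ← hlaw i (pulls h i),
    map_measureReal_apply (hX _ _) (Set.to_countable _).measurableSet]
  rfl

omit [IsProbabilityMeasure μ] [∀ i, IsProbabilityMeasure (P i)] in
lemma measureReal_run_fibre_inter (hX : ∀ i n, Measurable (X i n))
    (hlaw : ∀ i n, μ.map (X i n) = P i)
    (hindep : iIndepFun (fun (p : Fin K × ℕ) => X p.1 p.2) μ)
    (hUX : IndepFun U (fun ω (p : Fin K × ℕ) => X p.1 p.2 ω) μ)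
    (hpol : ∀ h, Measurable fun s => pol s h) (t : ℕ) (h : History K E) (i : Fin K)
    (G : Set E) :
    μ.real ((fun ω => (run (pol (U ω)) (fun i n => X i n ω) t,
      pol (U ω) (run (pol (U ω)) (fun i n => X i n ω) t))) ⁻¹' {(h, i)} ∩ X i (pulls h i) ⁻¹' G) =
    μ.real ((fun ω => (run (pol (U ω)) (fun i n => X i n ω) t,
      pol (U ω) (run (pol (U ω)) (fun i n => X i n ω) t))) ⁻¹' {(h, i)}) * (P i).real G := by
  rw [run_fibre_eq]
  by_cases hl : h.length = t
  swap
  · simp [hl]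
  set B : Set S := {s | RequestsOf (pol s) h ∧ pol s h = i}
  have hB : MeasurableSet B :=
    (measurableSet_requestsOf hpol h).inter (hpol h (measurableSet_singleton i))
  have hset : {ω | h.length = t ∧ (RequestsOf (pol (U ω)) h ∧ pol (U ω) h = i) ∧
      AnswersOf (fun i n => X i n ω) h} =
      U ⁻¹' B ∩ {ω | AnswersOf (fun i n => X i n ω) h} := by
    ext ω
    exact and_iff_right hl
  -- Used with and without the next answer: the factor of `U` separates in both cases, leaving
  -- independence among the answers.
  have key : ∀ D : Set (Fin K × ℕ → E), MeasurableSet D →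
      μ.real (U ⁻¹' B ∩ (fun ω (p : Fin K × ℕ) => X p.1 p.2 ω) ⁻¹' D) =
        μ.real (U ⁻¹' B) * μ.real ((fun ω (p : Fin K × ℕ) => X p.1 p.2 ω) ⁻¹' D) := by
    intro D hD
    rw [Measure.real, hUX.measure_inter_preimage_eq_mul _ _ hB hD, ENNReal.toReal_mul]
    rfl
  have hD1 : MeasurableSet {z : Fin K × ℕ → E | AnswersOf (fun i n => z (i, n)) h} :=
    measurableSet_answersOf (X := fun i n (z : Fin K × ℕ → E) => z (i, n))
      (fun i n => measurable_pi_apply _) h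
  have hD2 : MeasurableSet {z : Fin K × ℕ → E | z (i, pulls h i) ∈ G} :=
    measurable_pi_apply _ (Set.to_countable G).measurableSet
  have k1 := key _ hD1
  have k2 := key _ (hD1.inter hD2)
  have e1 : (fun ω (p : Fin K × ℕ) => X p.1 p.2 ω) ⁻¹'
      {z : Fin K × ℕ → E | AnswersOf (fun i n => z (i, n)) h} =
      {ω | AnswersOf (fun i n => X i n ω) h} := rfl
  have e2 : (fun ω (p : Fin K × ℕ) => X p.1 p.2 ω) ⁻¹'
      {z : Fin K × ℕ → E | z (i, pulls h i) ∈ G} = X i (pulls h i) ⁻¹' G := rfl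
  rw [Set.preimage_inter] at k2
  rw [e1] at k1 k2
  rw [e2, measureReal_answersOf_inter hX hlaw hindep] at k2
  rw [hset, Set.inter_assoc, k1, k2, mul_assoc]

omit [MeasurableSingletonClass E] in
lemma measure_compl_supp (ν : Measure E) : ν (supp ν)ᶜ = 0 := by
  rw [← Set.biUnion_of_singleton (supp ν)ᶜ]
  refine (measure_biUnion_null_iff (Set.to_countable _)).2 fun y hy => ?_
  by_contra h
  exact hy h

omit [IsProbabilityMeasure μ] [∀ i, IsProbabilityMeasure (P i)] in
lemma ae_mem_supp (hX : ∀ i n, Measurable (X i n)) (hlaw : ∀ i n, μ.map (X i n) = P i) :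
    ∀ᵐ ω ∂μ, ∀ i n, X i n ω ∈ supp (P i) := by
  rw [ae_all_iff]
  intro i
  rw [ae_all_iff]
  intro n
  have h := measure_compl_supp (P i)
  rw [← hlaw i n, Measure.map_apply (hX i n) (Set.to_countable _).measurableSet, hlaw i n] at h
  exact h

omit [MeasurableSingletonClass E] in
-- Interesting items revealed by other experts are outside `supp (P i)`, so removing them changes
-- nothing in mass. This links `found`, which is global, to the missing mass of a single expert.
lemma missingMass_run_eq {A : Set E} (hA : NonIntersecting A P) {x : Fin K → ℕ → E}
    (hx : ∀ i n, x i n ∈ supp (P i)) (π : Policy K E) (t : ℕ) (i : Fin K) :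
    (P i).real (A \ seen (run π x t)) = missingMass A P (run π x t) i := by
  refine le_antisymm (measureReal_mono fun y hy => ⟨hy.1, fun h => hy.2 ⟨i, h⟩⟩) ?_
  have hsub : A \ {y | (i, y) ∈ run π x t} ⊆ (A \ seen (run π x t)) ∪ (supp (P i))ᶜ := by
    rintro y ⟨hyA, hy⟩
    by_cases hs : y ∈ seen (run π x t)
    · right
      intro hyi
      obtain ⟨j, hj⟩ := hs
      have hji : i ≠ j := by
        rintro rfl
        exact hy hj
      obtain ⟨m, _, rfl⟩ := (mem_run_iff π x t j y).1 hj
      have : x j m ∈ A ∩ supp (P i) ∩ supp (P j) := ⟨⟨hyA, hyi⟩, hx _ _⟩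
      rw [hA i j hji] at this
      exact this
    · exact Or.inl ⟨hyA, hs⟩
  have h0 : (P i).real (supp (P i))ᶜ = 0 := by
    rw [Measure.real, measure_compl_supp]
    rfl
  have := (measureReal_mono (μ := P i) hsub).trans (measureReal_union_le _ _)
  rw [h0, add_zero] at this
  exact this

lemma measurable_comp_run (hX : ∀ i n, Measurable (X i n)) (hU : Measurable U)
    (hpol : ∀ h, Measurable fun s => pol s h) (t : ℕ) {β : Type*} [MeasurableSpace β]
    (c : History K E → Fin K → β) :
    Measurable fun ω => c (run (pol (U ω)) (fun i n => X i n ω) t)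
      (pol (U ω) (run (pol (U ω)) (fun i n => X i n ω) t)) :=
  measurable_comp_of_fibres (measurableSet_run_fibre hX hU hpol t) fun p => c p.1 p.2

lemma integrable_missingMass_run (hX : ∀ i n, Measurable (X i n)) (hU : Measurable U)
    (hpol : ∀ h, Measurable fun s => pol s h) (A : Set E) (t : ℕ) :
    Integrable (fun ω => missingMass A P (run (pol (U ω)) (fun i n => X i n ω) t)
      (pol (U ω) (run (pol (U ω)) (fun i n => X i n ω) t))) μ := by
  refine Integrable.of_bound
    (measurable_comp_run hX hU hpol t (missingMass A P)).aestronglyMeasurable 1 ?_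
  refine Filter.Eventually.of_forall fun ω => ?_
  exact abs_measureReal_le_one _ _

lemma integrable_found_run (hX : ∀ i n, Measurable (X i n)) (hU : Measurable U)
    (hpol : ∀ h, Measurable fun s => pol s h) (A : Set E) (t : ℕ) :
    Integrable (fun ω => (found A (run (pol (U ω)) (fun i n => X i n ω) t) : ℝ)) μ := by
  refine Integrable.of_bound
    (measurable_comp_run hX hU hpol t fun h _ => (found A h : ℝ)).aestronglyMeasurable t ?_
  refine Filter.Eventually.of_forall fun ω => ?_
  rw [Real.norm_eq_abs, abs_of_nonneg (Nat.cast_nonneg _), Nat.cast_le]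
  exact (found_le_length A _).trans (length_run _ _ _).le

/-- The expected number of items found is the expected sum of the missing masses of the requested
experts. -/
lemma integral_found_run (hX : ∀ i n, Measurable (X i n)) (hlaw : ∀ i n, μ.map (X i n) = P i)
    (hindep : iIndepFun (fun (p : Fin K × ℕ) => X p.1 p.2) μ) (hU : Measurable U)
    (hUX : IndepFun U (fun ω (p : Fin K × ℕ) => X p.1 p.2 ω) μ)
    (hpol : ∀ h, Measurable fun s => pol s h) {A : Set E} (hA : NonIntersecting A P) (t : ℕ) :
    ∫ ω, (found A (run (pol (U ω)) (fun i n => X i n ω) t) : ℝ) ∂μ =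
      ∑ s ∈ Finset.range t, ∫ ω, missingMass A P (run (pol (U ω)) (fun i n => X i n ω) s)
        (pol (U ω) (run (pol (U ω)) (fun i n => X i n ω) s)) ∂μ := by
  induction t with
  | zero => simp [run, found]
  | succ t ih =>
    rw [Finset.sum_range_succ, ← ih]
    set J : Ω → History K E × Fin K := fun ω => (run (pol (U ω)) (fun i n => X i n ω) t,
      pol (U ω) (run (pol (U ω)) (fun i n => X i n ω) t)) with hJ
    set D : History K E × Fin K → Set Ω :=
      fun p => X p.2 (pulls p.1 p.2) ⁻¹' (A \ seen p.1) with hD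
    have hJm := measurableSet_run_fibre hX hU hpol t
    have hDm : ∀ p, MeasurableSet (D p) :=
      fun p => hX _ _ (Set.to_countable _).measurableSet
    have h1 := measureReal_eq_integral_of_fibres (μ := μ) hJm hDm
      (c := fun p => (P p.2).real (A \ seen p.1)) (fun p => abs_measureReal_le_one _ _)
      fun p => measureReal_run_fibre_inter hX hlaw hindep hUX hpol t p.1 p.2 _
    have h2 : ∫ ω, (P (J ω).2).real (A \ seen (J ω).1) ∂μ =
        ∫ ω, missingMass A P (run (pol (U ω)) (fun i n => X i n ω) t)
          (pol (U ω) (run (pol (U ω)) (fun i n => X i n ω) t)) ∂μ := by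
      refine integral_congr_ae ?_
      filter_upwards [ae_mem_supp hX hlaw] with ω hω
      exact missingMass_run_eq hA hω _ _ _
    have hm := measurableSet_of_fibres hJm hDm
    have hint : Integrable ({ω | ω ∈ D (J ω)}.indicator (1 : Ω → ℝ)) μ :=
      (integrable_const (1 : ℝ)).indicator hm
    rw [← h2, ← h1, ← integral_indicator_one hm,
      ← integral_add (integrable_found_run hX hU hpol A t) hint]
    congr with ω
    rw [run, found_cons]
    rfl

end ExpectedFound

end Discovery

/-! ### The regret bound. -/

theorem theorem1 {Ω E S : Type*} [MeasurableSpace Ω] [MeasurableSpace S]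
    [Countable E] [MeasurableSpace E] [MeasurableSingletonClass E]
    (μ : Measure Ω) [IsProbabilityMeasure μ]
    -- the experts, and the interesting items
    (K : ℕ) (hK : 1 ≤ K) (P : Fin K → Measure E) [∀ i, IsProbabilityMeasure (P i)]
    (A : Set E) (hA : Discovery.NonIntersecting A P)
    -- the independent answers of the experts
    (X : Fin K → ℕ → Ω → E) (hX : ∀ i n, Measurable (X i n))
    (hlaw : ∀ i n, μ.map (X i n) = P i)
    (hindep : iIndepFun (fun (p : Fin K × ℕ) => X p.1 p.2) μ)
    -- a source of randomness for the tie-breaking, independent of the answers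
    (U : Ω → S) (hU : Measurable U)
    (hUX : IndepFun U (fun ω (p : Fin K × ℕ) => X p.1 p.2 ω) μ)
    -- Good-UCB and the oracle closed-loop policy
    (ucb ocl : S → Discovery.Policy K E)
    (hucb_meas : ∀ h, Measurable (fun s => ucb s h))
    (hocl_meas : ∀ h, Measurable (fun s => ocl s h))
    (hucb : ∀ s, Discovery.IsGoodUCB A ((1 + Real.sqrt 2) * Real.sqrt 3) (ucb s))
    (hocl : ∀ s, Discovery.IsOCL A P (ocl s))
    (t : ℕ) (ht : K ≤ t) :
    Integrable (fun ω =>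
      (Discovery.found A (Discovery.run (ocl (U ω)) (fun i n => X i n ω) t) : ℝ)
        - (Discovery.found A (Discovery.run (ucb (U ω)) (fun i n => X i n ω) t) : ℝ)) μ ∧
    ∫ ω, ((Discovery.found A (Discovery.run (ocl (U ω)) (fun i n => X i n ω) t) : ℝ)
        - (Discovery.found A (Discovery.run (ucb (U ω)) (fun i n => X i n ω) t) : ℝ)) ∂μ
      ≤ 17 * Real.sqrt ((K : ℝ) * t * Real.log t) + 20 * Real.sqrt ((K : ℝ) * t)
        + K + K * Real.log ((t : ℝ) / K) := by
  classical
  have hio := Discovery.integrable_found_run (μ := μ) hX hU hocl_meas A t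
  have hiu := Discovery.integrable_found_run (μ := μ) hX hU hucb_meas A t
  refine ⟨hio.sub hiu, ?_⟩
  have hmo := fun s => Discovery.integrable_missingMass_run (μ := μ) (P := P) hX hU hocl_meas A s
  have hmu := fun s => Discovery.integrable_missingMass_run (μ := μ) (P := P) hX hU hucb_meas A s
  have hbad : ∀ s, MeasurableSet {ω | ¬Discovery.Confident A P (fun i n => X i n ω) s} :=
    fun s => (Discovery.measurableSet_confident hX A s).compl
  have hbadint : ∀ s, Integrable ({ω | ¬Discovery.Confident A P (fun i n => X i n ω) s}.indicator
      (1 : Ω → ℝ)) μ := fun s => (integrable_const (1 : ℝ)).indicator (hbad s)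
  set R : ℝ := K + K * Real.log (t / K) + 2 * ((1 + Real.sqrt 2) * Real.sqrt 3) *
    Real.sqrt (Real.log (4 * t)) * (2 * Real.sqrt (K * t) - K) with hR
  rw [integral_sub hio hiu,
    Discovery.integral_found_run hX hlaw hindep hU hUX hocl_meas hA,
    Discovery.integral_found_run hX hlaw hindep hU hUX hucb_meas hA,
    ← integral_finsetSum _ fun s _ => hmo s, ← integral_finsetSum _ fun s _ => hmu s,
    ← integral_sub (integrable_finsetSum _ fun s _ => hmo s)
      (integrable_finsetSum _ fun s _ => hmu s)]
  have hsumint := integrable_finsetSum (Finset.Ico K t) fun s _ => hbadint s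
  have hKsumint : Integrable (fun ω => (K : ℝ) + ∑ s ∈ Finset.Ico K t,
      {ω | ¬Discovery.Confident A P (fun i n => X i n ω) s}.indicator (1 : Ω → ℝ) ω) μ :=
    (integrable_const _).add hsumint
  calc _ ≤ ∫ ω, (K + ∑ s ∈ Finset.Ico K t,
          {ω | ¬Discovery.Confident A P (fun i n => X i n ω) s}.indicator (1 : Ω → ℝ) ω +
            R) ∂μ := by
        refine integral_mono_ae ((integrable_finsetSum _ fun s _ => hmo s).sub
          (integrable_finsetSum _ fun s _ => hmu s))
          (hKsumint.add (integrable_const _)) ?_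
        -- The pathwise bound needs every answer to lie in its expert's support, which holds almost
        -- surely.
        filter_upwards [Discovery.ae_mem_supp hX hlaw] with ω hω
        have := Discovery.sum_missingMass_sub_le hK hA Discovery.four_le_ucbParam (hucb (U ω))
          (hocl (U ω)) hω ht
        rw [← Finset.sum_sub_distrib]
        refine this.trans_eq ?_
        congr 2
        refine Finset.sum_congr rfl fun s _ => ?_
        by_cases hc : Discovery.Confident A P (fun i n => X i n ω) s
        · rw [if_pos hc, Set.indicator_of_notMem]
          exact fun h => h hc
        · rw [if_neg hc, Set.indicator_of_mem]
          · rfl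
          · exact hc
    _ = K + ∑ s ∈ Finset.Ico K t,
          μ.real {ω | ¬Discovery.Confident A P (fun i n => X i n ω) s} + R := by
        rw [integral_add hKsumint (integrable_const _),
          integral_add (integrable_const _) hsumint, integral_finsetSum _ fun s _ => hbadint s]
        simp only [integral_indicator_one (hbad _), integral_const, probReal_univ, one_smul]
    _ ≤ K + ∑ s ∈ Finset.Ico K t, (K : ℝ) / 8 * (1 / ((s : ℝ) + 1)) + R := by
        gcongr with s _
        exact Discovery.measureReal_not_confident_le hX hlaw hindep A s
    _ ≤ K + K / 8 * Real.log (t / K) + R := by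
        rw [← Finset.mul_sum]
        gcongr
        exact Discovery.sum_Ico_inv_succ_le hK ht
    _ ≤ _ := Discovery.regret_arith (by exact_mod_cast hK) (by exact_mod_cast ht)
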